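/- Let $\omega\subset\mathbb R^2$ be a bounded open set, let $f,g$ be real functions that are smooth on $\overline\omega$ (i.e. near every point of $\overline\omega$) with $f<g$ on $\overline\omega$, and put $$a=g-f,\qquad \Omega=\{(x',x_3):\ x'\in\omega,\ f(x')<x_3<g(x')\}.$$ Fix $H=(H_1,H_2,H_3)\in\mathbb R^3$, let $$F_*=H_3-(H_1,H_2)\cdot\nabla\Big(\tfrac{f+g}{2}\Big)\quad\text{on }\omega ,$$ and let $B_*\in L^2(\omega;\mathbb R^2)$ satisfy $\nabla\times B_*=F_*$ in the sense of distributions on $\omega$, where $\nabla\times j=\partial_1j_2-\partial_2j_1$ for planar fields. Let $\mathcal Z$ be the set of fields $(j(x'),0)\in L^2(\Omega;\mathbb R^3)$, identified with their planar part $j$, whose Jacobian $\frac12\nabla\times(j,0)$ is a finite $\mathbb R^3$-valued Radon measure on $\Omega$. For planar fields $j$ on $\omega$ define the mean-field functional $$I_\infty(j)=\tfrac12\|a\,\nabla\times j\|_{\mathfrak M(\omega)}+\tfrac12\int_\omega a\,|j-B_*|^2\,dx\ \text{ if } j\in\mathcal Z,\qquad I_\infty(j)=\infty\ \text{ otherwise,}$$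 where $\|T\|_{\mathfrak M(\omega)}=\sup\{\langle T,\varphi\rangle:\varphi\in C_c^\infty(\omega),\ |\varphi|\le1\}$ is the total variation norm. If $j\in\mathcal Z$ is a global minimizer of $I_\infty$, then there is $\zeta\in H^1_0(\omega)$ with $$j=B_*-\frac1a\nabla^\perp\zeta\quad\text{a.e. in }\omega,\qquad \nabla^\perp\zeta=(\partial_2\zeta,-\partial_1\zeta),$$ which solves the two-obstacle problem $$\min_{\xi\in H^1_0(\omega),\ |\xi|\le a/2\ \text{a.e.}}\ \int_\omega\Big[\frac1{2a}|\nabla\xi|^2-F_*\,\xi\Big]dx .$$ -/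

import Mathlib

open MeasureTheory Filter Topology
open scoped ENNReal

noncomputable section

namespace ThinFilm

/-- The plane `ℝ²`, with its Euclidean norm. -/
abbrev Plane := EuclideanSpace ℝ (Fin 2)

/-- The values of three-dimensional vector fields: `ℝ³` with its Euclidean norm. -/
abbrev Vec3 := EuclideanSpace ℝ (Fin 3)

/-- Points of physical space, written `x = (x', x₃)` with `x' ∈ ℝ²` and `x₃ ∈ ℝ`. The volume
on this product is Lebesgue measure on `ℝ³`. -/
abbrev Space := Plane × ℝ

/-! ### Test functions and derivatives -/

/-- `φ ∈ C_c^∞(U; V)`. -/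
def IsTest {E V : Type*} [NormedAddCommGroup E] [NormedSpace ℝ E]
    [NormedAddCommGroup V] [NormedSpace ℝ V] (U : Set E) (φ : E → V) : Prop :=
  ContDiff ℝ (⊤ : ℕ∞) φ ∧ HasCompactSupport φ ∧ tsupport φ ⊆ U

/-- The partial derivative `∂_{i+1} φ` of a function on the plane. -/
def pd2 (i : Fin 2) (φ : Plane → ℝ) (x : Plane) : ℝ :=
  fderiv ℝ φ x (EuclideanSpace.single i 1)

/-- The standard basis of `ℝ³ = ℝ² × ℝ`. -/
def basis3 : Fin 3 → Space :=
  ![(EuclideanSpace.single 0 1, 0), (EuclideanSpace.single 1 1, 0), (0, 1)]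

/-- The partial derivative `∂_{i+1} φ` of a function on space. -/
def pd3 (i : Fin 3) (φ : Space → ℝ) (x : Space) : ℝ :=
  fderiv ℝ φ x (basis3 i)

/-- The classical gradient `∇φ` of a function on the plane. -/
def grad2 (φ : Plane → ℝ) (x : Plane) : Plane := !₂[pd2 0 φ x, pd2 1 φ x]

/-- The classical curl `∇ × Φ` of a vector field on space. -/
def curl3 (Φ : Space → Vec3) (x : Space) : Vec3 :=
  !₂[pd3 1 (fun y => Φ y 2) x - pd3 2 (fun y => Φ y 1) x,
     pd3 2 (fun y => Φ y 0) x - pd3 0 (fun y => Φ y 2) x,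
     pd3 0 (fun y => Φ y 1) x - pd3 1 (fun y => Φ y 0) x]

/-- Rotation of a gradient: if `G = ∇ζ`, then `perp G = ∇^⊥ζ = (∂₂ζ, -∂₁ζ)`. -/
def perp (G : Plane) : Plane := !₂[G 1, -G 0]

/-! ### The film -/

/-- The film `Ω = {(x', x₃) : x' ∈ ω, f(x') < x₃ < g(x')}`. -/
def film (ω : Set Plane) (f g : Plane → ℝ) : Set Space :=
  {x | x.1 ∈ ω ∧ f x.1 < x.2 ∧ x.2 < g x.1}

/-- The thickness `a = g - f`. -/
def thickness (f g : Plane → ℝ) (x : Plane) : ℝ := g x - f x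

/-- The effective field `F_* = H₃ - (H₁, H₂) · ∇'((f + g)/2)`. -/
def effectiveField (H : Vec3) (f g : Plane → ℝ) (x : Plane) : ℝ :=
  H 2 - (H 0 * pd2 0 (fun y => (f y + g y) / 2) x + H 1 * pd2 1 (fun y => (f y + g y) / 2) x)

/-! ### Currents, Jacobians and the mean-field functional -/

/-- The three-dimensional field `(x', x₃) ↦ (j(x'), 0)` with planar profile `j`. -/
def planarField (j : Plane → Plane) (x : Space) : Vec3 := !₂[j x.1 0, j x.1 1, 0]

/-- `½ ∇ × v = J` in the sense of distributions on `Ω`, for a vector-valued finite Radon measure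
`J = (J₁, J₂, J₃)`: for all `Φ ∈ C_c^∞(Ω; ℝ³)`, `½ ∫_Ω v · (∇ × Φ) = ∫ Φ · dJ`.
(Only the restriction of `J` to `Ω` matters.) -/
def IsJacobian (Ω : Set Space) (v : Space → Vec3) (J : Fin 3 → SignedMeasure Space) : Prop :=
  ∀ Φ : Space → Vec3, IsTest Ω Φ →
    (1 / 2) * ∫ x in Ω, inner ℝ (v x) (curl3 Φ x) = ∑ i, ∫ᵛ x, Φ x i ∂•(J i)

/-- The class `𝒵` of fields `(j(x'), 0) ∈ L²(Ω; ℝ³)` whose Jacobian `½ ∇ × (j, 0)` is a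
vector-valued Radon measure on `Ω`; a field is represented by its planar profile `j`. -/
def Z (ω : Set Plane) (f g : Plane → ℝ) : Set (Plane → Plane) :=
  {j | AEStronglyMeasurable j (volume.restrict ω) ∧
    MemLp (planarField j) 2 (volume.restrict (film ω f g)) ∧
    ∃ J : Fin 3 → SignedMeasure Space, IsJacobian (film ω f g) (planarField j) J}

/-- The scalar distribution `∇ × j = ∂₁j₂ - ∂₂j₁` on `ω`, evaluated at `φ`. -/
def curlDist (ω : Set Plane) (j : Plane → Plane) (φ : Plane → ℝ) : ℝ :=
  ∫ x in ω, (j x 0 * pd2 1 φ x - j x 1 * pd2 0 φ x)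

/-- The norm `‖T‖_{𝔐(ω)} = sup {⟨T, φ⟩ : φ ∈ C_c^∞(ω), |φ| ≤ 1}` of a distribution `T` on `ω`.
It is the total variation of `T` if `T` is a finite signed measure, and `∞` otherwise. -/
def radonNorm (ω : Set Plane) (T : (Plane → ℝ) → ℝ) : ℝ≥0∞ :=
  ⨆ (φ : Plane → ℝ) (_ : IsTest ω φ ∧ ∀ x, |φ x| ≤ 1), ENNReal.ofReal (T φ)

open Classical in
/-- The mean-field functional
`I_∞(j) = ½ ‖a ∇ × j‖_{𝔐(ω)} + ½ ∫_ω a |j - B|²` for `j ∈ 𝒵`, and `∞` otherwise. -/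
def meanField (ω : Set Plane) (f g : Plane → ℝ) (B j : Plane → Plane) : ℝ≥0∞ :=
  if j ∈ Z ω f g then
    (1 / 2) * radonNorm ω (fun φ => curlDist ω j (fun x => thickness f g x * φ x)) +
    (1 / 2) * ∫⁻ x in ω, ENNReal.ofReal (thickness f g x * ‖j x - B x‖ ^ 2)
  else ⊤

/-! ### The two-obstacle problem -/

/-- `u ∈ H¹₀(ω)` with weak gradient `∇u = G`, where `H¹₀(ω)` is the closure of `C_c^∞(ω)` in
`H¹(ω)`. -/
structure IsH10 (ω : Set Plane) (u : Plane → ℝ) (G : Plane → Plane) : Prop where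
  memLp : MemLp u 2 (volume.restrict ω)
  memLp_grad : MemLp G 2 (volume.restrict ω)
  weak_grad : ∀ φ : Plane → ℝ, IsTest ω φ → ∀ i : Fin 2,
    ∫ x in ω, u x * pd2 i φ x = -∫ x in ω, G x i * φ x
  approx : ∃ φ : ℕ → Plane → ℝ, (∀ n, IsTest ω (φ n)) ∧
    Tendsto (fun n => eLpNorm (fun x => φ n x - u x) 2 (volume.restrict ω)) atTop (𝓝 0) ∧
    Tendsto (fun n => eLpNorm (fun x => grad2 (φ n) x - G x) 2 (volume.restrict ω)) atTop (𝓝 0)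

/-- The energy `∫_ω [|∇ξ|² / (2a) - F ξ]`, with `X = ∇ξ`. -/
def obstacleEnergy (ω : Set Plane) (a F ξ : Plane → ℝ) (X : Plane → Plane) : ℝ :=
  ∫ x in ω, (1 / (2 * a x) * ‖X x‖ ^ 2 - F x * ξ x)

/-- `ξ ∈ H¹₀(ω)`, with `∇ξ = X`, satisfies the two-sided constraint `|ξ| ≤ a/2`. -/
def IsAdmissible (ω : Set Plane) (a ξ : Plane → ℝ) (X : Plane → Plane) : Prop :=
  IsH10 ω ξ X ∧ ∀ᵐ x ∂(volume.restrict ω), |ξ x| ≤ a x / 2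

/-- `ζ`, with `∇ζ = G`, minimizes the energy among all admissible functions. -/
def SolvesObstacleProblem (ω : Set Plane) (a F ζ : Plane → ℝ) (G : Plane → Plane) : Prop :=
  IsAdmissible ω a ζ G ∧
    ∀ (ξ : Plane → ℝ) (X : Plane → Plane), IsAdmissible ω a ξ X →
      obstacleEnergy ω a F ζ G ≤ obstacleEnergy ω a F ξ X

end ThinFilm

end

/-!
The minimality of `j` is tested only against explicit competitors.

Write `a` for the thickness, `r = ‖a ∇ × j‖` and `⟨u, k⟩` for the pairing in `L²(ω; ℝ²)`. Along
`j + t k` the quadratic part of the functional has derivative `⟨a (j - B), k⟩`, and the total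
variation grows at most linearly in `t`; this is `first_variation`. Three families of
directions `k` suffice.

* If `∇ × k = 0`, the total variation does not change, so `a (B - j)` is orthogonal to all
  curl-free fields. These form the orthogonal complement of the rotated gradients of test functions,
  so `a (B - j)` is a limit of such gradients, and Poincaré's inequality turns it into `∇^⊥ζ` with
  `ζ ∈ H¹₀(ω)`: `exists_stream_function`.
* If `∇ × k` is the indicator function of a set `A ⊆ ω`, then `⟨∇^⊥ζ, k⟩ = ∫_A ζ`, and minimality
  gives `|∫_A ζ| ≤ ½ ∫_A a`. Such a `k` exists for every measurable `A` (`exists_current_of_set`),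
  so `|ζ| ≤ a / 2`.
* The direction `k = -j` gives `r / 2 ≤ ⟨j, ∇^⊥ζ⟩`: `variation_scaling`.

Both the first and the second family belong to `Z` because integration along vertical lines reduces
the Jacobian in the film to the planar curl (`mem_Z_of_curlDist`). Finally, the derivative of the
obstacle energy at `ζ` in the direction `η ∈ H¹₀(ω)` is `-⟨j, ∇^⊥η⟩`. For admissible `ξ` one has
`⟨j, ∇^⊥ξ⟩ ≤ r / 2` (`integral_inner_perp_le`): this is the definition of the total variation if
`2 ξ / a` is a test function bounded by `1`, and in general `ξ / a` is approximated by smooth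
truncations of test functions. Hence the derivative in the direction `ξ - ζ` is nonnegative, and by
convexity `ζ` is a minimizer (`obstacleEnergy_le`).
-/

noncomputable section

namespace ThinFilm

/-! ### Rotated gradients and test functions -/

/-- The rotation `perp` as a linear isometry of the plane. -/
def perpL : Plane →ₗᵢ[ℝ] Plane where
  toFun := perp
  map_add' x y := by ext i; fin_cases i <;> simp [perp]; ring
  map_smul' c x := by ext i; fin_cases i <;> simp [perp]
  norm_map' x := by
    simp [perp, EuclideanSpace.norm_eq, Fin.sum_univ_two, add_comm]

theorem perp_add (x y : Plane) : perp (x + y) = perp x + perp y := perpL.map_add x y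

theorem perp_sub (x y : Plane) : perp (x - y) = perp x - perp y := perpL.map_sub x y

theorem perp_smul (c : ℝ) (x : Plane) : perp (c • x) = c • perp x := perpL.map_smul c x

theorem perp_neg (x : Plane) : perp (-x) = -perp x := perpL.map_neg x

theorem norm_perp (x : Plane) : ‖perp x‖ = ‖x‖ := perpL.norm_map x

theorem perp_perp (x : Plane) : perp (perp x) = -x := by
  ext i; fin_cases i <;> simp [perp]

theorem inner_perp_perp (x y : Plane) : inner ℝ (perp x) (perp y) = inner ℝ x y :=
  perpL.inner_map_map x y

theorem continuous_perp : Continuous perp := perpL.continuous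

theorem memLp_perp {ν : Measure Plane} {p : ℝ≥0∞} {G : Plane → Plane} (hG : MemLp G p ν) :
    MemLp (fun x => perp (G x)) p ν :=
  hG.of_le (continuous_perp.comp_aestronglyMeasurable hG.1)
    (Eventually.of_forall fun x => (norm_perp (G x)).le)

theorem inner_plane (x y : Plane) : inner ℝ x y = x 0 * y 0 + x 1 * y 1 := by
  simp [PiLp.inner_apply, Fin.sum_univ_two, mul_comm]

theorem curlDist_eq_integral_inner (ω : Set Plane) (k : Plane → Plane) (φ : Plane → ℝ) :
    curlDist ω k φ = ∫ x in ω, inner ℝ (k x) (perp (grad2 φ x)) := by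
  unfold curlDist
  congr 1 with x
  rw [inner_plane]
  simp [perp, grad2]
  ring

section Test

variable {E : Type*} [NormedAddCommGroup E] [NormedSpace ℝ E]

theorem isTest_zero {V : Type*} [NormedAddCommGroup V] [NormedSpace ℝ V] (U : Set E) :
    IsTest U (fun _ : E => (0 : V)) := by
  refine ⟨contDiff_const, HasCompactSupport.zero, ?_⟩
  have : tsupport (fun _ : E => (0 : V)) = ∅ := by
    rw [tsupport_eq_empty_iff]; rfl
  simp [this]

theorem IsTest.eq_zero_of_notMem {V : Type*} [NormedAddCommGroup V] [NormedSpace ℝ V]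
    {U : Set E} {φ : E → V} (hφ : IsTest U φ) {x : E} (hx : x ∉ U) : φ x = 0 :=
  image_eq_zero_of_notMem_tsupport fun h => hx (hφ.2.2 h)

theorem IsTest.add {V : Type*} [NormedAddCommGroup V] [NormedSpace ℝ V] {U : Set E}
    {φ ψ : E → V} (hφ : IsTest U φ) (hψ : IsTest U ψ) : IsTest U (fun x => φ x + ψ x) :=
  ⟨hφ.1.add hψ.1, hφ.2.1.add hψ.2.1,
    (tsupport_add φ ψ).trans (Set.union_subset hφ.2.2 hψ.2.2)⟩

/-- A factor need only be smooth on `U` for its product with a test function to be a test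
function on the whole space. -/
theorem IsTest.mul_left {U : Set E} {a φ : E → ℝ} (ha : ∀ x ∈ U, ContDiffAt ℝ (⊤ : ℕ∞) a x)
    (hφ : IsTest U φ) : IsTest U (fun x => a x * φ x) := by
  refine ⟨contDiff_iff_contDiffAt.2 fun x => ?_, hφ.2.1.mul_left,
    (tsupport_mul_subset_right).trans hφ.2.2⟩
  by_cases hx : x ∈ tsupport φ
  · exact (ha x (hφ.2.2 hx)).mul hφ.1.contDiffAt
  · have h0 : φ =ᶠ[𝓝 x] 0 := notMem_tsupport_iff_eventuallyEq.1 hx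
    have : (fun x => a x * φ x) =ᶠ[𝓝 x] fun _ => 0 := by
      filter_upwards [h0] with y hy
      simp [hy]
    exact contDiffAt_const.congr_of_eventuallyEq this

theorem IsTest.const_mul {U : Set E} {φ : E → ℝ} (c : ℝ) (hφ : IsTest U φ) :
    IsTest U (fun x => c * φ x) :=
  hφ.mul_left fun _ _ => contDiffAt_const

theorem IsTest.comp_left {U : Set E} {φ : E → ℝ} (hφ : IsTest U φ) {T : ℝ → ℝ}
    (hT : ContDiff ℝ (⊤ : ℕ∞) T) (h0 : T 0 = 0) : IsTest U (fun x => T (φ x)) :=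
  ⟨hT.comp hφ.1, hφ.2.1.comp_left h0,
    (closure_mono (Function.support_comp_subset h0 φ)).trans hφ.2.2⟩

theorem IsTest.fderiv_apply {V : Type*} [NormedAddCommGroup V] [NormedSpace ℝ V] {U : Set E}
    {φ : E → V} (hφ : IsTest U φ) (v : E) :
    IsTest U (fun x => fderiv ℝ φ x v) := by
  have hs : tsupport (fun x => fderiv ℝ φ x v) ⊆ tsupport φ := by
    refine (closure_mono ?_).trans (tsupport_fderiv_subset ℝ)
    intro x hx h
    exact hx (by simp [h])
  refine ⟨?_, hφ.2.1.mono' (subset_closure.trans hs), hs.trans hφ.2.2⟩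
  exact (hφ.1.fderiv_right (by simp)).clm_apply contDiff_const

theorem IsTest.differentiable {V : Type*} [NormedAddCommGroup V] [NormedSpace ℝ V] {U : Set E}
    {φ : E → V} (hφ : IsTest U φ) : Differentiable ℝ φ :=
  hφ.1.differentiable (by simp)

theorem IsTest.continuous {V : Type*} [NormedAddCommGroup V] [NormedSpace ℝ V] {U : Set E}
    {φ : E → V} (hφ : IsTest U φ) : Continuous φ := hφ.1.continuous

theorem IsTest.exists_bound {V : Type*} [NormedAddCommGroup V] [NormedSpace ℝ V] {U : Set E}
    {φ : E → V} (hφ : IsTest U φ) : ∃ C, ∀ x, ‖φ x‖ ≤ C :=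
  hφ.2.1.exists_bound_of_continuous hφ.continuous

theorem IsTest.memLp {V : Type*} [NormedAddCommGroup V] [NormedSpace ℝ V] [MeasurableSpace E]
    [OpensMeasurableSpace E] [SecondCountableTopologyEither E V] {U : Set E}
    {φ : E → V} (hφ : IsTest U φ) (ν : Measure E) [IsFiniteMeasureOnCompacts ν] (p : ℝ≥0∞) :
    MemLp φ p ν :=
  hφ.continuous.memLp_of_hasCompactSupport hφ.2.1

end Test

theorem IsTest.pd2 {U : Set Plane} {φ : Plane → ℝ} (hφ : IsTest U φ) (i : Fin 2) :
    IsTest U (ThinFilm.pd2 i φ) := hφ.fderiv_apply _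

theorem IsTest.pd3 {U : Set Space} {φ : Space → ℝ} (hφ : IsTest U φ) (i : Fin 3) :
    IsTest U (ThinFilm.pd3 i φ) := hφ.fderiv_apply _

theorem grad2_apply (φ : Plane → ℝ) (x : Plane) (i : Fin 2) : grad2 φ x i = pd2 i φ x := by
  fin_cases i <;> rfl

theorem IsTest.memLp_grad2 {U : Set Plane} {φ : Plane → ℝ} (hφ : IsTest U φ) (ν : Measure Plane)
    [IsFiniteMeasureOnCompacts ν] (p : ℝ≥0∞) : MemLp (grad2 φ) p ν := by
  refine MemLp.of_eval_piLp fun i => ?_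
  simpa only [grad2_apply] using (hφ.pd2 i).memLp ν p

theorem norm_fderiv_le_grad2 (φ : Plane → ℝ) (x : Plane) : ‖fderiv ℝ φ x‖ ≤ 2 * ‖grad2 φ x‖ := by
  refine ContinuousLinearMap.opNorm_le_bound _ (by positivity) fun v => ?_
  have hv : v = v 0 • EuclideanSpace.single 0 1 + v 1 • EuclideanSpace.single 1 1 := by
    ext i; fin_cases i <;> simp
  have h : fderiv ℝ φ x v = v 0 * grad2 φ x 0 + v 1 * grad2 φ x 1 := by
    conv_lhs => rw [hv]
    simp [grad2, pd2]
  rw [h]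
  have h0 := PiLp.norm_apply_le v 0
  have h1 := PiLp.norm_apply_le v 1
  have h2 := PiLp.norm_apply_le (grad2 φ x) 0
  have h3 := PiLp.norm_apply_le (grad2 φ x) 1
  calc ‖v 0 * grad2 φ x 0 + v 1 * grad2 φ x 1‖
      ≤ ‖v 0‖ * ‖grad2 φ x 0‖ + ‖v 1‖ * ‖grad2 φ x 1‖ := by
        refine (norm_add_le _ _).trans ?_
        rw [norm_mul, norm_mul]
    _ ≤ ‖v‖ * ‖grad2 φ x‖ + ‖v‖ * ‖grad2 φ x‖ := by gcongr
    _ = 2 * ‖grad2 φ x‖ * ‖v‖ := by ring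

/-! ### Pairings of square-integrable functions -/

section Pairing

variable {X E : Type*} [MeasurableSpace X] {ν : Measure X} [NormedAddCommGroup E]
  [InnerProductSpace ℝ E]

theorem integral_inner_eq_inner_toLp {k f : X → E} (hk : MemLp k 2 ν) (hf : MemLp f 2 ν) :
    ∫ x, inner ℝ (k x) (f x) ∂ν = inner ℝ (hk.toLp k) (hf.toLp f) := by
  rw [L2.inner_def]
  refine integral_congr_ae ?_
  filter_upwards [hk.coeFn_toLp, hf.coeFn_toLp] with x h1 h2
  rw [h1, h2]

theorem integrable_inner_of_memLp {k f : X → E} (hk : MemLp k 2 ν) (hf : MemLp f 2 ν) :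
    Integrable (fun x => inner ℝ (k x) (f x)) ν := by
  refine (L2.integrable_inner (𝕜 := ℝ) (hk.toLp k) (hf.toLp f)).congr ?_
  filter_upwards [hk.coeFn_toLp, hf.coeFn_toLp] with x h1 h2
  rw [h1, h2]

theorem tendsto_integral_inner {k f : X → E} {F : ℕ → X → E} (hk : MemLp k 2 ν)
    (hF : ∀ n, MemLp (F n) 2 ν) (hf : MemLp f 2 ν)
    (h : Tendsto (fun n => eLpNorm (fun x => F n x - f x) 2 ν) atTop (𝓝 0)) :
    Tendsto (fun n => ∫ x, inner ℝ (k x) (F n x) ∂ν) atTop (𝓝 (∫ x, inner ℝ (k x) (f x) ∂ν)) := by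
  have h1 : Tendsto (fun n => (hF n).toLp (F n)) atTop (𝓝 (hf.toLp f)) :=
    (Lp.tendsto_Lp_iff_tendsto_eLpNorm'' F hF f hf).2 h
  simp only [fun n => integral_inner_eq_inner_toLp hk (hF n), integral_inner_eq_inner_toLp hk hf]
  exact tendsto_const_nhds.inner h1

end Pairing

/-! ### The space of currents is a vector space -/

theorem signedMeasure_variation_finite {X : Type*} [MeasurableSpace X] (s : SignedMeasure X) :
    IsFiniteMeasure s.variation := by
  rw [← s.totalVariation_eq_variation]
  infer_instance

theorem planarField_add (j k : Plane → Plane) (x : Space) :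
    planarField (fun y => j y + k y) x = planarField j x + planarField k x := by
  ext i; fin_cases i <;> simp [planarField]

theorem planarField_smul (c : ℝ) (j : Plane → Plane) (x : Space) :
    planarField (fun y => c • j y) x = c • planarField j x := by
  ext i; fin_cases i <;> simp [planarField]

theorem IsTest.eval {U : Set Space} {Φ : Space → Vec3} (hΦ : IsTest U Φ) (i : Fin 3) :
    IsTest U (fun x => Φ x i) := by
  have hs : tsupport (fun x => Φ x i) ⊆ tsupport Φ := by
    refine closure_mono fun x hx h => hx ?_
    simp [h]
  exact ⟨(contDiff_piLp 2).1 hΦ.1 i, hΦ.2.1.mono' (subset_closure.trans hs), hs.trans hΦ.2.2⟩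

theorem IsTest.memLp_curl3 {U : Set Space} {Φ : Space → Vec3} (hΦ : IsTest U Φ)
    (ν : Measure Space) [IsFiniteMeasureOnCompacts ν] (p : ℝ≥0∞) : MemLp (curl3 Φ) p ν := by
  have h (i j : Fin 3) := ((hΦ.eval j).pd3 i).memLp ν p
  refine MemLp.of_eval_piLp fun i => ?_
  fin_cases i
  · exact (h 1 2).sub (h 2 1)
  · exact (h 2 0).sub (h 0 2)
  · exact (h 0 1).sub (h 1 0)

theorem integrable_signedMeasure {U : Set Space} {Φ : Space → Vec3} (hΦ : IsTest U Φ)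
    (J : SignedMeasure Space) (i : Fin 3) : J.Integrable (fun x => Φ x i) := by
  have := signedMeasure_variation_finite J
  obtain ⟨C, hC⟩ := (hΦ.eval i).exists_bound
  exact Integrable.of_bound (hΦ.eval i).continuous.aestronglyMeasurable C
    (Eventually.of_forall hC)

theorem Z_add {ω : Set Plane} {f g : Plane → ℝ} {j k : Plane → Plane} (hj : j ∈ Z ω f g)
    (hk : k ∈ Z ω f g) : (fun x => j x + k x) ∈ Z ω f g := by
  obtain ⟨hj1, hj2, J, hJ⟩ := hj
  obtain ⟨hk1, hk2, K, hK⟩ := hk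
  refine ⟨hj1.add hk1, ?_, J + K, fun Φ hΦ => ?_⟩
  · rw [show planarField (fun x => j x + k x) = planarField j + planarField k from
      funext fun x => planarField_add j k x]
    exact hj2.add hk2
  · have hc := hΦ.memLp_curl3 (volume.restrict (film ω f g)) 2
    simp only [planarField_add, inner_add_left]
    rw [integral_add (integrable_inner_of_memLp hj2 hc) (integrable_inner_of_memLp hk2 hc), mul_add,
      hJ Φ hΦ, hK Φ hΦ, ← Finset.sum_add_distrib]
    refine Finset.sum_congr rfl fun i _ => ?_
    rw [Pi.add_apply, VectorMeasure.integral_add_vectorMeasure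
      (integrable_signedMeasure hΦ _ i) (integrable_signedMeasure hΦ _ i)]

theorem Z_smul {ω : Set Plane} {f g : Plane → ℝ} {j : Plane → Plane} (hj : j ∈ Z ω f g)
    (c : ℝ) : (fun x => c • j x) ∈ Z ω f g := by
  obtain ⟨hj1, hj2, J, hJ⟩ := hj
  refine ⟨hj1.const_smul c, ?_, c • J, fun Φ hΦ => ?_⟩
  · rw [show planarField (fun x => c • j x) = c • planarField j from
      funext fun x => planarField_smul c j x]
    exact hj2.const_smul c
  · simp only [planarField_smul, real_inner_smul_left, integral_const_mul, Pi.smul_apply,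
      VectorMeasure.integral_smul_vectorMeasure, smul_eq_mul, ← Finset.mul_sum]
    rw [← hJ Φ hΦ]
    ring
/-! ### Currents whose curl is the indicator of a set -/

/-- The integral of a function on space along the vertical lines. -/
def vint (ψ : Space → ℝ) (x : Plane) : ℝ := ∫ t, ψ (x, t)

section Vertical

variable {U : Set Space} {ω : Set Plane} {ψ : Space → ℝ}

theorem notMem_tsupport_of_snd {x : Plane} {t : ℝ} (ht : t ∉ Prod.snd '' tsupport ψ) :
    (x, t) ∉ tsupport ψ := fun h => ht ⟨_, h, rfl⟩

theorem hasCompactSupport_slice (hψ : IsTest U ψ) (x : Plane) :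
    HasCompactSupport (fun t => ψ (x, t)) :=
  HasCompactSupport.intro (hψ.2.1.isCompact.image continuous_snd) fun _ ht =>
    image_eq_zero_of_notMem_tsupport (notMem_tsupport_of_snd ht)

theorem integrable_slice (hψ : IsTest U ψ) (x : Plane) : Integrable (fun t => ψ (x, t)) :=
  (hψ.continuous.comp (Continuous.prodMk_right x)).integrable_of_hasCompactSupport
    (hasCompactSupport_slice hψ x)

/-- The vertical integral of a test function on a set above `ω` is a test function on `ω`. -/
theorem isTest_vint (hU : ∀ x ∈ U, x.1 ∈ ω) (hψ : IsTest U ψ) : IsTest ω (vint ψ) := by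
  have hsupp : tsupport (vint ψ) ⊆ Prod.fst '' tsupport ψ := by
    refine closure_minimal ?_ (hψ.2.1.isCompact.image continuous_fst).isClosed
    intro x hx
    by_contra h
    refine hx ?_
    have : ∀ t, ψ (x, t) = 0 := fun t =>
      image_eq_zero_of_notMem_tsupport fun ht => h ⟨_, ht, rfl⟩
    simp [vint, this]
  refine ⟨?_, HasCompactSupport.of_support_subset_isCompact (hψ.2.1.isCompact.image continuous_fst)
    (subset_closure.trans hsupp), ?_⟩
  · -- the vertical integral is a convolution with the constant `1`, evaluated at height `0`
    have h := contDiffOn_convolution_right_with_param_comp (𝕜 := ℝ) (n := (⊤ : ℕ∞))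
      (μ := (volume : Measure ℝ)) (ContinuousLinearMap.lsmul ℝ ℝ) (s := (Set.univ : Set Plane))
      (v := fun _ => (0 : ℝ)) contDiffOn_const (f := fun _ => (1 : ℝ))
      (g := fun x t => ψ (x, -t)) (k := Neg.neg ⁻¹' (Prod.snd '' tsupport ψ)) isOpen_univ
      ((hψ.2.1.isCompact.image continuous_snd).neg)
      (fun x t _ ht => image_eq_zero_of_notMem_tsupport (notMem_tsupport_of_snd ht))
      (locallyIntegrable_const 1)
      ((hψ.1.comp (contDiff_fst.prodMk contDiff_snd.neg)).contDiffOn)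
    have h2 : (fun x => convolution (fun _ : ℝ => (1 : ℝ)) (fun t => ψ (x, -t))
        (ContinuousLinearMap.lsmul ℝ ℝ) volume 0) = vint ψ := by
      funext x
      simp [convolution, vint]
    rw [h2] at h
    exact contDiffOn_univ.1 h
  · rintro x hx
    obtain ⟨y, hy, rfl⟩ := hsupp hx
    exact hU y (hψ.2.2 hy)

theorem fderiv_vint_apply (hψ : IsTest U ψ) (x e : Plane) :
    fderiv ℝ (vint ψ) x e = ∫ t, fderiv ℝ ψ (x, t) (e, 0) := by
  obtain ⟨C, hC⟩ := (hψ.2.1.fderiv ℝ).exists_bound_of_continuous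
    (hψ.1.continuous_fderiv (by simp))
  set S : Set ℝ := Prod.snd '' tsupport ψ
  have hS : IsCompact S := hψ.2.1.isCompact.image continuous_snd
  have hcont : Continuous fun t => (fderiv ℝ ψ (x, t)).comp (ContinuousLinearMap.inl ℝ Plane ℝ) :=
    ((hψ.1.continuous_fderiv (by simp)).comp (Continuous.prodMk_right x)).clm_comp
      continuous_const
  have hb : ∀ t, ∀ y : Plane, ‖(fderiv ℝ ψ (y, t)).comp (ContinuousLinearMap.inl ℝ Plane ℝ)‖ ≤
      S.indicator (fun _ => C * ‖ContinuousLinearMap.inl ℝ Plane ℝ‖) t := by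
    intro t y
    by_cases ht : t ∈ S
    · rw [Set.indicator_of_mem ht]
      exact (ContinuousLinearMap.opNorm_comp_le _ _).trans (by gcongr; exact hC _)
    · rw [Set.indicator_of_notMem ht]
      have : fderiv ℝ ψ (y, t) = 0 := image_eq_zero_of_notMem_tsupport fun h =>
        notMem_tsupport_of_snd ht (tsupport_fderiv_subset ℝ h)
      simp [this]
  have hbi : Integrable (S.indicator (fun _ => C * ‖ContinuousLinearMap.inl ℝ Plane ℝ‖)) := by
    rw [integrable_indicator_iff hS.measurableSet]
    exact integrableOn_const hS.measure_lt_top.ne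
  have h := hasFDerivAt_integral_of_dominated_of_fderiv_le (𝕜 := ℝ) (μ := (volume : Measure ℝ))
    (F := fun y t => ψ (y, t))
    (F' := fun y t => (fderiv ℝ ψ (y, t)).comp (ContinuousLinearMap.inl ℝ Plane ℝ))
    (x₀ := x) (s := Set.univ) (bound := S.indicator fun _ => C * ‖ContinuousLinearMap.inl ℝ Plane ℝ‖)
    univ_mem
    (Eventually.of_forall fun y =>
      (hψ.continuous.comp (Continuous.prodMk_right y)).aestronglyMeasurable)
    (integrable_slice hψ x) hcont.aestronglyMeasurable
    (Eventually.of_forall fun t y _ => hb t y) hbi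
    (Eventually.of_forall fun t y _ =>
      (hψ.differentiable (y, t)).hasFDerivAt.comp y (hasFDerivAt_prodMk_left y t))
  rw [show vint ψ = fun y => ∫ t, ψ (y, t) from rfl, h.fderiv,
    ContinuousLinearMap.integral_apply]
  · rfl
  · exact hbi.mono' hcont.aestronglyMeasurable (Eventually.of_forall fun t => hb t x)

theorem vint_pd3_horizontal (hψ : IsTest U ψ) (x : Plane) :
    vint (pd3 0 ψ) x = pd2 0 (vint ψ) x ∧ vint (pd3 1 ψ) x = pd2 1 (vint ψ) x :=
  ⟨(fderiv_vint_apply hψ x _).symm, (fderiv_vint_apply hψ x _).symm⟩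

theorem vint_pd3_vertical (hψ : IsTest U ψ) (x : Plane) : vint (pd3 2 ψ) x = 0 := by
  refine integral_eq_zero_of_hasDerivAt_of_integrable (f := fun t => ψ (x, t)) (fun t => ?_)
    (integrable_slice (hψ.pd3 2) x) (integrable_slice hψ x)
  have h1 : HasDerivAt (fun s : ℝ => (x, s)) ((0 : Plane), (1 : ℝ)) t :=
    (hasDerivAt_const t x).prodMk (hasDerivAt_id t)
  exact (hψ.differentiable (x, t)).hasFDerivAt.comp_hasDerivAt t h1

theorem integrable_prod_mul (hψ : IsTest U ψ) {c : Plane → ℝ}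
    (hc : Integrable c (volume.restrict ω)) :
    Integrable (fun x : Space => c x.1 * ψ x) ((volume.restrict ω).prod volume) := by
  obtain ⟨C, hC⟩ := hψ.exists_bound
  set S : Set ℝ := Prod.snd '' tsupport ψ
  have hS : IsCompact S := hψ.2.1.isCompact.image continuous_snd
  have hbi : Integrable (S.indicator (fun _ => C)) := by
    rw [integrable_indicator_iff hS.measurableSet]
    exact integrableOn_const hS.measure_lt_top.ne
  refine (hc.norm.mul_prod hbi).mono' (hc.1.comp_fst.mul hψ.continuous.aestronglyMeasurable)
    (Eventually.of_forall fun x => ?_)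
  rw [norm_mul]
  refine mul_le_mul_of_nonneg_left ?_ (norm_nonneg _)
  by_cases ht : x.2 ∈ S
  · rw [Set.indicator_of_mem ht]; exact hC x
  · rw [Set.indicator_of_notMem ht]
    have : ψ x = 0 := image_eq_zero_of_notMem_tsupport (notMem_tsupport_of_snd (x := x.1) ht)
    simp [this]

theorem prod_restrict_univ_eq (ω : Set Plane) :
    (volume : Measure Space).restrict (ω ×ˢ Set.univ) = (volume.restrict ω).prod volume := by
  rw [Measure.volume_eq_prod, ← Measure.prod_restrict, Measure.restrict_univ]

theorem integrableOn_mul_of_isTest (hU : ∀ x ∈ U, x.1 ∈ ω) (hψ : IsTest U ψ) {c : Plane → ℝ}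
    (hc : Integrable c (volume.restrict ω)) :
    Integrable (fun x : Space => c x.1 * ψ x) (volume.restrict U) := by
  have h := integrable_prod_mul hψ hc
  rw [← prod_restrict_univ_eq] at h
  have hsub : U ⊆ ω ×ˢ Set.univ := fun x hx => ⟨hU x hx, trivial⟩
  exact h.mono_measure (Measure.restrict_mono hsub le_rfl)

/-- Fubini's theorem for the product of a planar function with a test function on space. -/
theorem setIntegral_mul_eq_vint (hω : MeasurableSet ω) (hU : ∀ x ∈ U, x.1 ∈ ω)
    (hψ : IsTest U ψ) {c : Plane → ℝ} (hc : Integrable c (volume.restrict ω)) :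
    ∫ x in U, c x.1 * ψ x = ∫ x in ω, c x * vint ψ x := by
  rw [← setIntegral_eq_of_subset_of_forall_sdiff_eq_zero (s := U)
    (hω.prod MeasurableSet.univ) (fun x hx => ⟨hU x hx, trivial⟩)
    (fun x hx => by rw [hψ.eq_zero_of_notMem hx.2, mul_zero]),
    prod_restrict_univ_eq, integral_prod _ (integrable_prod_mul hψ hc)]
  simp only [integral_const_mul, vint]

end Vertical

section Film

variable {ω : Set Plane} {f g : Plane → ℝ}

theorem exists_film_subset (hωb : Bornology.IsBounded ω) (hf : ContinuousOn f (closure ω))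
    (hg : ContinuousOn g (closure ω)) : ∃ R : ℝ, film ω f g ⊆ ω ×ˢ Set.Icc (-R) R := by
  have hc : IsCompact (closure ω) := hωb.isCompact_closure
  obtain ⟨R₁, h1⟩ := hc.exists_bound_of_continuousOn hf
  obtain ⟨R₂, h2⟩ := hc.exists_bound_of_continuousOn hg
  refine ⟨max R₁ R₂, fun x hx => ⟨hx.1, ?_, ?_⟩⟩
  · have := (abs_le.1 (h1 x.1 (subset_closure hx.1))).1
    linarith [hx.2.1, le_max_left R₁ R₂]
  · have := (abs_le.1 (h2 x.1 (subset_closure hx.1))).2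
    linarith [hx.2.2, le_max_right R₁ R₂]

theorem restrict_film_le {R : ℝ} (hR : film ω f g ⊆ ω ×ˢ Set.Icc (-R) R) :
    (volume : Measure Space).restrict (film ω f g) ≤
      (volume.restrict ω).prod (volume.restrict (Set.Icc (-R) R)) := by
  rw [Measure.prod_restrict, ← Measure.volume_eq_prod]
  exact Measure.restrict_mono hR le_rfl

theorem memLp_planarField (hωb : Bornology.IsBounded ω) (hf : ContinuousOn f (closure ω))
    (hg : ContinuousOn g (closure ω)) {k : Plane → Plane} (hk : MemLp k 2 (volume.restrict ω)) :
    MemLp (planarField k) 2 (volume.restrict (film ω f g)) := by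
  obtain ⟨R, hR⟩ := exists_film_subset hωb hf hg
  have h : MemLp (fun x : Space => k x.1) 2 (volume.restrict (film ω f g)) :=
    (hk.comp_fst (volume.restrict (Set.Icc (-R) R))).mono_measure (restrict_film_le hR)
  refine MemLp.of_eval_piLp fun i => ?_
  fin_cases i
  · exact h.eval_piLp 0
  · exact h.eval_piLp 1
  · exact MemLp.zero'

/-- A square-integrable current whose planar curl is the indicator function of a measurable set
`A` belongs to `Z`: its Jacobian is half of Lebesgue measure on the part of the film above `A`,
pointing in the vertical direction. -/
theorem mem_Z_of_curlDist (hω : IsOpen ω) (hωb : Bornology.IsBounded ω)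
    (hf : ∀ x ∈ closure ω, ContinuousAt f x) (hg : ∀ x ∈ closure ω, ContinuousAt g x)
    {k : Plane → Plane} (hk : MemLp k 2 (volume.restrict ω))
    {A : Set Plane} (hA : MeasurableSet A) (hAω : A ⊆ ω)
    (hcurl : ∀ φ, IsTest ω φ → curlDist ω k φ = ∫ x in A, φ x) : k ∈ Z ω f g := by
  have hfc : ContinuousOn f (closure ω) := fun x hx => (hf x hx).continuousWithinAt
  have hgc : ContinuousOn g (closure ω) := fun x hx => (hg x hx).continuousWithinAt
  have hωfin : volume ω < ∞ := hωb.measure_lt_top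
  have : IsFiniteMeasure (volume.restrict ω) := ⟨by simpa using hωfin⟩
  set Ω := film ω f g with hΩ
  obtain ⟨R, hR⟩ := exists_film_subset hωb hfc hgc
  have hΩfin : IsFiniteMeasure ((volume : Measure Space).restrict Ω) :=
    isFiniteMeasure_of_le _ (restrict_film_le hR)
  have hU : ∀ x ∈ Ω, x.1 ∈ ω := fun x hx => hx.1
  set A' : Set Space := Prod.fst ⁻¹' A
  have hA' : MeasurableSet A' := measurable_fst hA
  set μ : Measure Space := ((volume : Measure Space).restrict Ω).restrict A' with hμ
  have hμfin : IsFiniteMeasure μ := by rw [hμ]; infer_instance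
  refine ⟨hk.1, memLp_planarField hωb hfc hgc hk,
    ![0, 0, (1 / 2 : ℝ) • μ.toSignedMeasure], fun Φ hΦ => ?_⟩
  have hk1 : ∀ i, Integrable (fun x => k x i) (volume.restrict ω) := fun i =>
    (hk.eval_piLp i).integrable (by norm_num)
  have hint (i : Fin 2) (l m : Fin 3) :
      Integrable (fun x : Space => k x.1 i * pd3 l (fun y => Φ y m) x) (volume.restrict Ω) :=
    integrableOn_mul_of_isTest hU ((hΦ.eval m).pd3 l) (hk1 i)
  have hint' (i : Fin 2) (l m l' m' : Fin 3) :
      Integrable (fun x : Space => k x.1 i * pd3 l (fun y => Φ y m) x -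
        k x.1 i * pd3 l' (fun y => Φ y m') x) (volume.restrict Ω) :=
    (hint i l m).sub (hint i l' m')
  have hfub (i : Fin 2) (l m : Fin 3) :
      ∫ x in Ω, k x.1 i * pd3 l (fun y => Φ y m) x =
        ∫ x in ω, k x i * vint (pd3 l (fun y => Φ y m)) x :=
    setIntegral_mul_eq_vint hω.measurableSet hU ((hΦ.eval m).pd3 l) (hk1 i)
  set φ := vint (fun y => Φ y 2) with hφ
  have hφt : IsTest ω φ := isTest_vint hU (hΦ.eval 2)
  have hLHS : ∫ x in Ω, inner ℝ (planarField k x) (curl3 Φ x) = curlDist ω k φ := by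
    have h1 : ∀ x, inner ℝ (planarField k x) (curl3 Φ x) =
        (k x.1 0 * pd3 1 (fun y => Φ y 2) x - k x.1 0 * pd3 2 (fun y => Φ y 1) x) +
        (k x.1 1 * pd3 2 (fun y => Φ y 0) x - k x.1 1 * pd3 0 (fun y => Φ y 2) x) := by
      intro x
      simp [PiLp.inner_apply, Fin.sum_univ_three, planarField, curl3]
      ring
    simp only [h1]
    rw [integral_add (hint' 0 1 2 2 1) (hint' 1 2 0 0 2),
      integral_sub (hint 0 1 2) (hint 0 2 1), integral_sub (hint 1 2 0) (hint 1 0 2),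
      hfub, hfub, hfub, hfub]
    simp only [vint_pd3_vertical (hΦ.eval _), (vint_pd3_horizontal (hΦ.eval 2) _).1,
      (vint_pd3_horizontal (hΦ.eval 2) _).2, mul_zero, integral_zero]
    rw [curlDist, integral_sub]
    · rw [sub_zero, zero_sub, sub_eq_add_neg]
    · exact (hk.eval_piLp 0).integrable_mul ((hφt.pd2 1).memLp _ 2)
    · exact (hk.eval_piLp 1).integrable_mul ((hφt.pd2 0).memLp _ 2)
  have hRHS : ∫ x, Φ x 2 ∂μ = ∫ x in A, φ x := by
    have hAi : Integrable (A.indicator fun _ => (1 : ℝ)) (volume.restrict ω) :=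
      (integrable_const 1).indicator hA
    have h2 := setIntegral_mul_eq_vint hω.measurableSet hU (hΦ.eval 2) hAi
    have h3 : ∀ x : Space, A.indicator (fun _ => (1 : ℝ)) x.1 * Φ x 2 =
        A'.indicator (fun y => Φ y 2) x := by
      intro x
      by_cases hx : x.1 ∈ A
      · rw [Set.indicator_of_mem hx, Set.indicator_of_mem (show x ∈ A' from hx), one_mul]
      · rw [Set.indicator_of_notMem hx, Set.indicator_of_notMem (show x ∉ A' from hx), zero_mul]
    have h4 : ∀ x : Plane, A.indicator (fun _ => (1 : ℝ)) x * φ x = A.indicator φ x := by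
      intro x
      by_cases hx : x ∈ A <;> simp [hx]
    simp only [h3, ← hφ, h4] at h2
    rw [integral_indicator hA', integral_indicator hA, Measure.restrict_restrict hA,
      Set.inter_eq_left.2 hAω] at h2
    exact h2
  have hflip : (ContinuousLinearMap.lsmul ℝ ℝ : ℝ →L[ℝ] ℝ →L[ℝ] ℝ) =
      (ContinuousLinearMap.lsmul ℝ ℝ : ℝ →L[ℝ] ℝ →L[ℝ] ℝ).flip := by
    ext; simp
  rw [hLHS, hcurl φ hφt, ← hRHS, Fin.sum_univ_three]
  simp only [Matrix.cons_val_zero, Matrix.cons_val_one, Matrix.cons_val,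
    VectorMeasure.integral_zero_vectorMeasure, VectorMeasure.integral_smul_vectorMeasure]
  rw [hflip, VectorMeasure.integral_toSignedMeasure]
  simp

end Film
/-! ### Stream functions in `H¹₀(ω)` -/

section Potential

variable {ω : Set Plane}

theorem pd2_linear {U : Set Plane} {φ ψ : Plane → ℝ} (hφ : IsTest U φ) (hψ : IsTest U ψ)
    (c : ℝ) (i : Fin 2) (x : Plane) :
    pd2 i (fun y => φ y + c * ψ y) x = pd2 i φ x + c * pd2 i ψ x := by
  unfold pd2
  rw [fderiv_fun_add (hφ.differentiable x) ((hψ.differentiable x).const_mul c),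
    fderiv_const_mul (hψ.differentiable x)]
  simp

theorem grad2_linear {U : Set Plane} {φ ψ : Plane → ℝ} (hφ : IsTest U φ) (hψ : IsTest U ψ)
    (c : ℝ) (x : Plane) :
    grad2 (fun y => φ y + c * ψ y) x = grad2 φ x + c • grad2 ψ x := by
  ext i
  simp [grad2_apply, pd2_linear hφ hψ]

theorem grad2_sub {U : Set Plane} {φ ψ : Plane → ℝ} (hφ : IsTest U φ) (hψ : IsTest U ψ)
    (x : Plane) : grad2 (fun y => φ y - ψ y) x = grad2 φ x - grad2 ψ x := by
  have h := grad2_linear hφ hψ (-1) x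
  simpa [sub_eq_add_neg] using h

theorem IsTest.sub {E : Type*} [NormedAddCommGroup E] [NormedSpace ℝ E] {U : Set E}
    {φ ψ : E → ℝ} (hφ : IsTest U φ) (hψ : IsTest U ψ) : IsTest U (fun x => φ x - ψ x) := by
  simpa [sub_eq_add_neg] using hφ.add (hψ.const_mul (-1))

theorem exists_gagliardo_nirenberg (ω : Set Plane) : ∃ c : NNReal, ∀ φ : Plane → ℝ, IsTest ω φ →
    eLpNorm φ ((2 : NNReal) : ℝ≥0∞) volume ≤ c * eLpNorm (fderiv ℝ φ) 1 volume := by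
  have hconj : NNReal.HolderConjugate (Module.finrank ℝ Plane) 2 := by
    rw [finrank_euclideanSpace_fin]
    exact_mod_cast NNReal.HolderConjugate.two_two
  exact ⟨_, fun φ hφ => eLpNorm_le_eLpNorm_fderiv_one (F := ℝ) (E := Plane) volume
    (hφ.1.of_le (by simp)) hφ.2.1 hconj⟩

/-- The Poincaré inequality, from the Gagliardo–Nirenberg–Sobolev inequality
`‖φ‖₂ ≤ C ‖∇φ‖₁` in the plane. -/
theorem exists_poincare (hω : volume ω < ∞) : ∃ C : NNReal, ∀ φ, IsTest ω φ →
    eLpNorm φ 2 (volume.restrict ω) ≤ C * eLpNorm (grad2 φ) 2 (volume.restrict ω) := by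
  obtain ⟨c, hc⟩ := exists_gagliardo_nirenberg ω
  refine ⟨c * (2 * ((volume ω) ^ (1 / 2 : ℝ)).toNNReal), fun φ hφ => ?_⟩
  have hfin : (volume ω) ^ (1 / 2 : ℝ) ≠ ∞ := ENNReal.rpow_ne_top_of_nonneg (by norm_num) hω.ne
  have h1 : eLpNorm φ 2 volume ≤ c * eLpNorm (fderiv ℝ φ) 1 volume := hc φ hφ
  have h2 : eLpNorm (fderiv ℝ φ) 1 volume = eLpNorm (fderiv ℝ φ) 1 (volume.restrict ω) := by
    rw [← eLpNorm_norm, ← eLpNorm_norm (fderiv ℝ φ), eLpNorm_restrict_eq_of_support_subset]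
    refine fun x hx => hφ.2.2 (tsupport_fderiv_subset ℝ (subset_tsupport _ fun h => hx ?_))
    simp [h]
  have h3 : eLpNorm (fderiv ℝ φ) 1 (volume.restrict ω) ≤
      2 * eLpNorm (grad2 φ) 1 (volume.restrict ω) := by
    have := eLpNorm_le_nnreal_smul_eLpNorm_of_ae_le_mul (c := 2) (p := 1)
      (μ := volume.restrict ω) (f := fderiv ℝ φ) (g := grad2 φ)
      (Eventually.of_forall fun x => norm_fderiv_le_grad2 φ x)
    simpa [ENNReal.smul_def] using this
  have h4 : eLpNorm (grad2 φ) 1 (volume.restrict ω) ≤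
      eLpNorm (grad2 φ) 2 (volume.restrict ω) * (volume ω) ^ (1 / 2 : ℝ) := by
    have := eLpNorm_le_eLpNorm_mul_rpow_measure_univ (p := 1) (q := 2) (by norm_num)
      (hφ.memLp_grad2 (volume.restrict ω) 2).1
    rw [Measure.restrict_apply_univ] at this
    convert this using 3
    norm_num
  calc eLpNorm φ 2 (volume.restrict ω) ≤ eLpNorm φ 2 volume :=
        eLpNorm_mono_measure _ Measure.restrict_le_self
    _ ≤ c * (2 * (eLpNorm (grad2 φ) 2 (volume.restrict ω) * (volume ω) ^ (1 / 2 : ℝ))) := by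
        refine h1.trans ?_
        rw [h2]
        gcongr
        exact h3.trans (by gcongr)
    _ = _ := by
        rw [ENNReal.coe_mul, ENNReal.coe_mul, ENNReal.coe_toNNReal hfin]
        push_cast
        ring

theorem setIntegral_mul_pd2 {φ ψ : Plane → ℝ} (hφ : IsTest ω φ) (hψ : IsTest ω ψ) (i : Fin 2) :
    ∫ x in ω, φ x * pd2 i ψ x = -∫ x in ω, pd2 i φ x * ψ x := by
  rw [setIntegral_eq_integral_of_forall_compl_eq_zero
      (fun x hx => by rw [hφ.eq_zero_of_notMem hx, zero_mul]),
    setIntegral_eq_integral_of_forall_compl_eq_zero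
      (fun x hx => by rw [hψ.eq_zero_of_notMem hx, mul_zero])]
  have hi {u v : Plane → ℝ} (hu : IsTest ω u) (hv : IsTest ω v) :
      Integrable (fun x => u x * v x) :=
    (hu.memLp volume 2).integrable_mul (hv.memLp volume 2)
  exact integral_mul_fderiv_eq_neg_fderiv_mul_of_integrable (hi (hφ.pd2 i) hψ)
    (hi hφ (hψ.pd2 i)) (hi hφ hψ) (fun x _ => hφ.differentiable x)
    fun x _ => hψ.differentiable x

/-- Convergence of gradients in `L²` passes to the limit in the distributional curl. -/
theorem tendsto_curlDist {k G : Plane → Plane} {φ : ℕ → Plane → ℝ}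
    (hk : MemLp k 2 (volume.restrict ω)) (hG : MemLp G 2 (volume.restrict ω))
    (hφ : ∀ n, IsTest ω (φ n))
    (h : Tendsto (fun n => eLpNorm (fun x => grad2 (φ n) x - G x) 2 (volume.restrict ω))
      atTop (𝓝 0)) :
    Tendsto (fun n => curlDist ω k (φ n)) atTop
      (𝓝 (∫ x in ω, inner ℝ (k x) (perp (G x)))) := by
  simp only [curlDist_eq_integral_inner]
  refine tendsto_integral_inner (F := fun n x => perp (grad2 (φ n) x)) hk
    (fun n => memLp_perp ((hφ n).memLp_grad2 _ 2)) (memLp_perp hG) ?_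
  refine h.congr fun n => eLpNorm_congr_norm_ae (Eventually.of_forall fun x => ?_)
  rw [← perp_sub, norm_perp]

/-- The distributional identity `∇ × k = μ` may be tested with functions in `H¹₀(ω)`. -/
theorem IsH10.integral_inner_perp {u : Plane → ℝ} {G k : Plane → Plane} {μ : Plane → ℝ}
    (hu : IsH10 ω u G) (hk : MemLp k 2 (volume.restrict ω)) (hμ : MemLp μ 2 (volume.restrict ω))
    (hcurl : ∀ φ, IsTest ω φ → curlDist ω k φ = ∫ x in ω, μ x * φ x) :
    ∫ x in ω, inner ℝ (k x) (perp (G x)) = ∫ x in ω, μ x * u x := by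
  obtain ⟨φ, hφ, h1, h2⟩ := hu.approx
  have ht := tendsto_curlDist hk hu.memLp_grad hφ h2
  have ht2 := tendsto_integral_inner hμ (fun n => (hφ n).memLp (volume.restrict ω) 2) hu.memLp h1
  simp only [Real.inner_apply] at ht2
  refine tendsto_nhds_unique ht (ht2.congr fun n => ?_)
  rw [hcurl _ (hφ n)]

theorem tendsto_eLpNorm_eval {X : Type*} [MeasurableSpace X] {ν : Measure X}
    {F : ℕ → X → Plane} {p : ℝ≥0∞} (i : Fin 2)
    (h : Tendsto (fun n => eLpNorm (F n) p ν) atTop (𝓝 0)) :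
    Tendsto (fun n => eLpNorm (fun x => F n x i) p ν) atTop (𝓝 0) :=
  tendsto_of_tendsto_of_tendsto_of_le_of_le tendsto_const_nhds h (fun _ => zero_le)
    fun n => eLpNorm_mono fun x => PiLp.norm_apply_le (F n x) i

theorem dist_toLp_le {C : NNReal}
    (hC : ∀ φ, IsTest ω φ →
      eLpNorm φ 2 (volume.restrict ω) ≤ C * eLpNorm (grad2 φ) 2 (volume.restrict ω))
    {φ ψ : Plane → ℝ} (hφ : IsTest ω φ) (hψ : IsTest ω ψ) :
    dist ((hφ.memLp (volume.restrict ω) 2).toLp φ) ((hψ.memLp (volume.restrict ω) 2).toLp ψ) ≤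
      C * dist ((hφ.memLp_grad2 (volume.restrict ω) 2).toLp (grad2 φ))
        ((hψ.memLp_grad2 (volume.restrict ω) 2).toLp (grad2 ψ)) := by
  rw [Lp.dist_edist, Lp.dist_edist, Lp.edist_toLp_toLp, Lp.edist_toLp_toLp,
    ← ENNReal.coe_toReal, ← ENNReal.toReal_mul]
  have hg : grad2 φ - grad2 ψ = grad2 (fun x => φ x - ψ x) :=
    funext fun x => (grad2_sub hφ hψ x).symm
  rw [hg]
  exact ENNReal.toReal_mono (ENNReal.mul_ne_top ENNReal.coe_ne_top
    ((hφ.sub hψ).memLp_grad2 _ 2).2.ne) (hC _ (hφ.sub hψ))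

/-- A limit in `L²` of gradients of test functions is the gradient of a function in `H¹₀(ω)`. -/
theorem exists_isH10_of_tendsto (hω : volume ω < ∞) {G : Plane → Plane}
    (hG : MemLp G 2 (volume.restrict ω)) {φ : ℕ → Plane → ℝ} (hφ : ∀ n, IsTest ω (φ n))
    (h : Tendsto (fun n => eLpNorm (fun x => grad2 (φ n) x - G x) 2 (volume.restrict ω))
      atTop (𝓝 0)) : ∃ ζ, IsH10 ω ζ G := by
  set ν := (volume : Measure Plane).restrict ω
  obtain ⟨C, hC⟩ := exists_poincare hω
  have hm (n : ℕ) : MemLp (φ n) 2 ν := (hφ n).memLp ν 2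
  have hgm (n : ℕ) : MemLp (grad2 (φ n)) 2 ν := (hφ n).memLp_grad2 ν 2
  have hgt : Tendsto (fun n => (hgm n).toLp (grad2 (φ n))) atTop (𝓝 (hG.toLp G)) :=
    (Lp.tendsto_Lp_iff_tendsto_eLpNorm'' _ hgm G hG).2 h
  have hcau : CauchySeq fun n => (hm n).toLp (φ n) := by
    refine Metric.cauchySeq_iff.2 fun ε hε => ?_
    obtain ⟨N, hN⟩ := Metric.cauchySeq_iff.1 hgt.cauchySeq (ε / (C + 1)) (by positivity)
    refine ⟨N, fun n hn m hm' => (dist_toLp_le hC (hφ n) (hφ m)).trans_lt ?_⟩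
    calc (C : ℝ) * dist ((hgm n).toLp (grad2 (φ n))) ((hgm m).toLp (grad2 (φ m)))
        ≤ C * (ε / (C + 1)) := by gcongr; exact (hN n hn m hm').le
      _ < (C + 1) * (ε / (C + 1)) := by gcongr; linarith
      _ = ε := by field_simp
  obtain ⟨ζ, hζ⟩ := cauchySeq_tendsto_of_complete hcau
  have hζm : MemLp ζ 2 ν := Lp.memLp ζ
  have hζt : Tendsto (fun n => eLpNorm (fun x => φ n x - ζ x) 2 ν) atTop (𝓝 0) := by
    refine (Lp.tendsto_Lp_iff_tendsto_eLpNorm'' _ hm ζ hζm).1 ?_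
    rwa [Lp.toLp_coeFn]
  refine ⟨ζ, hζm, hG, fun ψ hψ i => ?_, φ, hφ, hζt, h⟩
  have h1 := tendsto_integral_inner ((hψ.pd2 i).memLp ν 2) hm hζm hζt
  have h3 : Tendsto (fun n => eLpNorm (fun x => grad2 (φ n) x i - G x i) 2 ν) atTop (𝓝 0) :=
    tendsto_eLpNorm_eval (F := fun n x => grad2 (φ n) x - G x) i h
  have h2 := tendsto_integral_inner (F := fun n x => grad2 (φ n) x i) (f := fun x => G x i)
    (hψ.memLp ν 2) (fun n => (hgm n).eval_piLp i) (hG.eval_piLp i) h3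
  simp only [Real.inner_apply, grad2_apply] at h1 h2
  simp only [mul_comm (ζ _), mul_comm (G _ i)]
  refine tendsto_nhds_unique h1 (h2.neg.congr fun n => ?_)
  have := setIntegral_mul_pd2 (hφ n) hψ i
  simp only [mul_comm (pd2 i ψ _), mul_comm (ψ _)]
  exact this.symm

/-- A square-integrable field orthogonal to all curl-free fields is a rotated gradient
`∇^⊥ζ` with `ζ ∈ H¹₀(ω)`: the curl-free fields form the orthogonal complement of the rotated
gradients of test functions. -/
theorem exists_stream_function (hω : volume ω < ∞) {v : Plane → Plane}
    (hv : MemLp v 2 (volume.restrict ω))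
    (horth : ∀ k, MemLp k 2 (volume.restrict ω) →
      (∀ φ, IsTest ω φ → curlDist ω k φ = 0) → ∫ x in ω, inner ℝ (v x) (k x) = 0) :
    ∃ (ζ : Plane → ℝ) (G : Plane → Plane), IsH10 ω ζ G ∧ ∀ x, perp (G x) = v x := by
  set ν := (volume : Measure Plane).restrict ω
  have hpm {φ : Plane → ℝ} (hφ : IsTest ω φ) : MemLp (fun x => perp (grad2 φ x)) 2 ν :=
    memLp_perp (hφ.memLp_grad2 ν 2)
  have hlin {φ ψ : Plane → ℝ} (hφ : IsTest ω φ) (hψ : IsTest ω ψ) (c : ℝ) :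
      (hpm hφ).toLp _ + c • (hpm hψ).toLp _ = (hpm (hφ.add (hψ.const_mul c))).toLp _ := by
    rw [← MemLp.toLp_const_smul, ← MemLp.toLp_add]
    refine MemLp.toLp_congr _ _ (Eventually.of_forall fun x => ?_)
    simp only [Pi.add_apply, Pi.smul_apply]
    rw [grad2_linear hφ hψ, perp_add, perp_smul]
  have hzero : (hpm (isTest_zero (V := ℝ) ω)).toLp _ = 0 := by
    rw [← MemLp.toLp_zero (MemLp.zero (ε := Plane) (p := 2) (μ := ν))]
    refine MemLp.toLp_congr _ _ (Eventually.of_forall fun x => ?_)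
    have : grad2 (fun _ => (0 : ℝ)) x = 0 := by ext i; simp [grad2_apply, pd2]
    exact (congrArg perp this).trans perpL.map_zero
  let S : Submodule ℝ (Lp Plane 2 ν) :=
    { carrier := {u | ∃ φ, ∃ hφ : IsTest ω φ, u = (hpm hφ).toLp _}
      add_mem' := by
        rintro _ _ ⟨φ, hφ, rfl⟩ ⟨ψ, hψ, rfl⟩
        exact ⟨_, hφ.add (hψ.const_mul 1), by rw [← hlin hφ hψ 1, one_smul]⟩
      zero_mem' := ⟨_, isTest_zero ω, hzero.symm⟩
      smul_mem' := by
        rintro c _ ⟨ψ, hψ, rfl⟩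
        exact ⟨_, (isTest_zero ω).add (hψ.const_mul c),
          by rw [← hlin (isTest_zero ω) hψ c, hzero, zero_add]⟩ }
  have hmem : hv.toLp v ∈ closure (S : Set (Lp Plane 2 ν)) := by
    rw [← Submodule.topologicalClosure_coe, ← Submodule.orthogonal_orthogonal_eq_closure]
    refine (Submodule.mem_orthogonal' _ _).2 fun k hk => ?_
    have h := horth k (Lp.memLp k) fun φ hφ => by
      rw [curlDist_eq_integral_inner, integral_inner_eq_inner_toLp (Lp.memLp k) (hpm hφ),
        Lp.toLp_coeFn]
      exact (Submodule.mem_orthogonal' _ _).1 hk _ ⟨φ, hφ, rfl⟩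
    rw [integral_inner_eq_inner_toLp hv (Lp.memLp k), Lp.toLp_coeFn] at h
    exact h
  obtain ⟨u, huS, hu⟩ := mem_closure_iff_seq_limit.1 hmem
  choose φ hφ huφ using huS
  have hG : MemLp (fun x => -perp (v x)) 2 ν := (memLp_perp hv).neg
  have ht : Tendsto (fun n => eLpNorm (fun x => grad2 (φ n) x - -perp (v x)) 2 ν)
      atTop (𝓝 0) := by
    rw [funext huφ] at hu
    refine ((Lp.tendsto_Lp_iff_tendsto_eLpNorm'' _ (fun n => hpm (hφ n)) v hv).1 hu).congr
      fun n => eLpNorm_congr_norm_ae (Eventually.of_forall fun x => ?_)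
    rw [Pi.sub_apply, ← norm_perp (grad2 (φ n) x - -perp (v x)), perp_sub, perp_neg, perp_perp,
      neg_neg]
  obtain ⟨ζ, hζ⟩ := exists_isH10_of_tendsto hω hG hφ ht
  exact ⟨ζ, _, hζ, fun x => by rw [perp_neg, perp_perp, neg_neg]⟩

end Potential
/-! ### Currents with prescribed vorticity -/

section Vorticity

variable {ω : Set Plane}

/-- The integral of a test function along a horizontal segment that leaves `ω`. -/
theorem integral_pd2_segment {φ : Plane → ℝ} (hφ : IsTest ω φ) {x : Plane} {T : ℝ} (hT : 0 ≤ T)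
    (hx : x + T • EuclideanSpace.single 0 1 ∉ ω) :
    ∫ t in Set.Ioc 0 T, pd2 0 φ (x + t • EuclideanSpace.single 0 1) = -φ x := by
  have hd (t : ℝ) : HasDerivAt (fun s : ℝ => φ (x + s • EuclideanSpace.single 0 1))
      (pd2 0 φ (x + t • EuclideanSpace.single 0 1)) t := by
    have h1 : HasDerivAt (fun s : ℝ => x + s • (EuclideanSpace.single 0 1 : Plane))
        (EuclideanSpace.single 0 1) t := by
      simpa using ((hasDerivAt_id t).smul_const (EuclideanSpace.single 0 1 : Plane)).const_add x
    exact (hφ.differentiable _).hasFDerivAt.comp_hasDerivAt t h1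
  rw [← intervalIntegral.integral_of_le hT,
    intervalIntegral.integral_eq_sub_of_hasDerivAt (fun t _ => hd t)]
  · rw [hφ.eq_zero_of_notMem hx]
    simp
  · exact ((hφ.pd2 0).continuous.comp (by fun_prop)).intervalIntegrable _ _

/-- Every measurable subset `A` of `ω` carries a square-integrable current whose curl is the
indicator function of `A`: its first component vanishes, and its second one is the integral of the
indicator function over segments in the direction `-e₁` that are longer than the diameter
of `ω`. -/
theorem exists_current_of_set (hωb : Bornology.IsBounded ω) {A : Set Plane}
    (hA : MeasurableSet A) (hAω : A ⊆ ω) :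
    ∃ k, MemLp k 2 (volume.restrict ω) ∧
      ∀ φ, IsTest ω φ → curlDist ω k φ = ∫ x in A, φ x := by
  obtain ⟨R, hR0, hR⟩ := hωb.exists_pos_norm_le
  have : IsFiniteMeasure (volume.restrict ω) := ⟨by simpa using hωb.measure_lt_top⟩
  have hAfin : volume A < ∞ := (measure_mono hAω).trans_lt hωb.measure_lt_top
  set e : Plane := EuclideanSpace.single 0 1 with he
  have hen : ‖e‖ = 1 := by simp [he]
  -- any length exceeding `2 R` takes a point of `ω` out of `ω`
  set T : ℝ := 3 * R with hT
  have hT0 : 0 ≤ T := by positivity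
  have hexit : ∀ x ∈ ω, x + T • e ∉ ω := by
    intro x hx h
    have h1 := hR _ hx
    have h2 := hR _ h
    have h3 : ‖T • e‖ ≤ ‖x + T • e‖ + ‖x‖ := by
      have := norm_sub_le (x + T • e) x
      simpa using this
    rw [norm_smul, hen, mul_one, Real.norm_of_nonneg hT0] at h3
    linarith
  set τ : Measure ℝ := volume.restrict (Set.Ioc 0 T) with hτ
  have hτfin : IsFiniteMeasure τ := by rw [hτ]; infer_instance
  let χ : Plane → ℝ := A.indicator fun _ => 1
  have hχm : Measurable χ := measurable_const.indicator hA
  have hχ1 : ∀ x, ‖χ x‖ ≤ 1 := fun x => by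
    by_cases hx : x ∈ A <;> simp [χ, hx]
  have hm1 : Measurable fun p : Plane × ℝ => χ (p.1 - p.2 • e) := hχm.comp (by fun_prop)
  let K : Plane → ℝ := fun x => ∫ t, χ (x - t • e) ∂τ
  have hKm : StronglyMeasurable K := hm1.stronglyMeasurable.integral_prod_right
  have hKb : ∀ x, ‖K x‖ ≤ 1 * τ.real Set.univ := fun x =>
    norm_integral_le_of_norm_le_const (Eventually.of_forall fun t => hχ1 _)
  refine ⟨fun x => !₂[0, K x], ?_, fun φ hφ => ?_⟩
  · refine MemLp.of_eval_piLp fun i => ?_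
    fin_cases i
    · exact MemLp.zero'
    · exact MemLp.of_bound hKm.aestronglyMeasurable _ (Eventually.of_forall hKb)
  have hφ0 : Integrable (pd2 0 φ) :=
    (hφ.pd2 0).continuous.integrable_of_hasCompactSupport (hφ.pd2 0).2.1
  obtain ⟨C, hC⟩ := (hφ.pd2 0).exists_bound
  have hI1 : Integrable (fun p : Plane × ℝ => χ (p.1 - p.2 • e) * pd2 0 φ p.1)
      (volume.prod τ) := by
    refine (hφ0.norm.mul_prod (integrable_const (1 : ℝ))).mono'
      (hm1.aestronglyMeasurable.mul
        ((hφ.pd2 0).continuous.comp continuous_fst).aestronglyMeasurable)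
      (Eventually.of_forall fun p => ?_)
    rw [norm_mul, mul_comm]
    exact mul_le_mul_of_nonneg_left (hχ1 _) (norm_nonneg _)
  have hχi : Integrable χ := (integrable_indicator_iff hA).2 (integrableOn_const hAfin.ne)
  have hI2 : Integrable (fun p : Plane × ℝ => χ p.1 * pd2 0 φ (p.1 + p.2 • e))
      (volume.prod τ) := by
    refine (hχi.norm.mul_prod (integrable_const C)).mono'
      ((hχm.comp measurable_fst).aestronglyMeasurable.mul
        ((hφ.pd2 0).continuous.comp (by fun_prop)).aestronglyMeasurable)
      (Eventually.of_forall fun p => ?_)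
    rw [norm_mul]
    exact mul_le_mul_of_nonneg_left (hC _) (norm_nonneg _)
  have h1 : curlDist ω (fun x => !₂[0, K x]) φ = -∫ x, K x * pd2 0 φ x := by
    rw [← setIntegral_eq_integral_of_forall_compl_eq_zero (s := ω)
      (fun x hx => by rw [(hφ.pd2 0).eq_zero_of_notMem hx, mul_zero]), ← integral_neg]
    simp [curlDist]
  have h2 : ∫ x, K x * pd2 0 φ x =
      ∫ t, (∫ x, χ (x - t • e) * pd2 0 φ x) ∂τ := by
    simp only [K, ← integral_mul_const]
    exact integral_integral_swap hI1
  have h3 (t : ℝ) : ∫ x, χ (x - t • e) * pd2 0 φ x =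
      ∫ x, χ x * pd2 0 φ (x + t • e) := by
    rw [← integral_add_right_eq_self (μ := (volume : Measure Plane)) _ (t • e)]
    simp
  have h4 : ∫ t, (∫ x, χ x * pd2 0 φ (x + t • e)) ∂τ =
      ∫ x, χ x * ∫ t, pd2 0 φ (x + t • e) ∂τ := by
    rw [← integral_integral_swap hI2]
    simp only [integral_const_mul]
  have h5 : ∀ x, χ x * ∫ t, pd2 0 φ (x + t • e) ∂τ = A.indicator (fun y => -φ y) x := by
    intro x
    by_cases hx : x ∈ A
    · rw [Set.indicator_of_mem hx, integral_pd2_segment hφ hT0 (hexit x (hAω hx))]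
      simp [χ, hx]
    · simp [χ, hx]
  rw [h1, h2]
  simp only [h3]
  rw [h4]
  simp only [h5]
  rw [integral_indicator hA, integral_neg, neg_neg]

theorem ae_abs_le_of_setIntegral {u b : Plane → ℝ} (hω : MeasurableSet ω)
    (hu : Integrable u (volume.restrict ω)) (hb : Integrable b (volume.restrict ω))
    (h : ∀ A, MeasurableSet A → A ⊆ ω → |∫ x in A, u x| ≤ ∫ x in A, b x) :
    ∀ᵐ x ∂(volume.restrict ω), |u x| ≤ b x := by
  have key (s : Set Plane) (hs : MeasurableSet s) :
      |∫ x in s, u x ∂(volume.restrict ω)| ≤ ∫ x in s, b x ∂(volume.restrict ω) := by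
    rw [Measure.restrict_restrict hs]
    exact h _ (hs.inter hω) Set.inter_subset_right
  have h1 : u ≤ᵐ[volume.restrict ω] b := ae_le_of_forall_setIntegral_le hu hb
    fun s hs _ => (le_abs_self _).trans (key s hs)
  have h2 : (fun x => -u x) ≤ᵐ[volume.restrict ω] b := ae_le_of_forall_setIntegral_le hu.neg hb
    fun s hs _ => by
      rw [integral_neg]
      exact (neg_le_abs _).trans (key s hs)
  filter_upwards [h1, h2] with x a1 a2
  exact abs_le'.2 ⟨a1, a2⟩

end Vorticity
/-! ### Coefficients on the closure of a bounded open set -/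

section Coefficients

variable {ω : Set Plane}

theorem memLp_of_continuousOn_closure (hω : IsOpen ω) (hωb : Bornology.IsBounded ω)
    {c : Plane → ℝ} (hc : ContinuousOn c (closure ω)) (p : ℝ≥0∞) :
    MemLp c p (volume.restrict ω) := by
  have : IsFiniteMeasure (volume.restrict ω) := ⟨by simpa using hωb.measure_lt_top⟩
  obtain ⟨C, hC⟩ := hωb.isCompact_closure.exists_bound_of_continuousOn hc
  exact MemLp.of_bound ((hc.mono subset_closure).aestronglyMeasurable hω.measurableSet) C
    (ae_restrict_of_forall_mem hω.measurableSet fun x hx => hC x (subset_closure hx))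

/-- Multiplication by a function continuous on the compact set `closure ω` preserves `L^p(ω)`. -/
theorem memLp_smul_of_continuousOn_closure {E : Type*} [NormedAddCommGroup E] [NormedSpace ℝ E]
    (hω : IsOpen ω) (hωb : Bornology.IsBounded ω) {c : Plane → ℝ}
    (hc : ContinuousOn c (closure ω)) {p : ℝ≥0∞} {u : Plane → E}
    (hu : MemLp u p (volume.restrict ω)) :
    MemLp (fun x => c x • u x) p (volume.restrict ω) := by
  obtain ⟨C, hC⟩ := hωb.isCompact_closure.exists_bound_of_continuousOn hc
  refine MemLp.of_le_mul (c := C) hu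
    (((hc.mono subset_closure).aestronglyMeasurable hω.measurableSet).smul hu.1)
    (ae_restrict_of_forall_mem hω.measurableSet fun x hx => ?_)
  rw [norm_smul]
  exact mul_le_mul_of_nonneg_right (hC x (subset_closure hx)) (norm_nonneg _)

theorem integrable_mul_of_continuousOn_closure (hω : IsOpen ω) (hωb : Bornology.IsBounded ω)
    {c u : Plane → ℝ} (hc : ContinuousOn c (closure ω)) (hu : Integrable u (volume.restrict ω)) :
    Integrable (fun x => c x * u x) (volume.restrict ω) :=
  memLp_one_iff_integrable.1
    (memLp_smul_of_continuousOn_closure hω hωb hc (memLp_one_iff_integrable.2 hu))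

theorem continuousAt_pd2 {c : Plane → ℝ} {x : Plane} (hc : ContDiffAt ℝ (⊤ : ℕ∞) c x)
    (i : Fin 2) : ContinuousAt (pd2 i c) x :=
  ((hc.fderiv_right (m := 0) (by simp)).continuousAt).clm_apply continuousAt_const

end Coefficients

/-! ### The first variation of the mean-field functional -/

section Variation

variable {ω : Set Plane} {f g : Plane → ℝ}

theorem integrable_curlDist {k : Plane → Plane} (hk : MemLp k 2 (volume.restrict ω))
    {φ : Plane → ℝ} (hφ : IsTest ω φ) :
    Integrable (fun x => inner ℝ (k x) (perp (grad2 φ x))) (volume.restrict ω) :=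
  integrable_inner_of_memLp hk (memLp_perp (hφ.memLp_grad2 _ 2))

theorem curlDist_add_smul {j k : Plane → Plane} (hj : MemLp j 2 (volume.restrict ω))
    (hk : MemLp k 2 (volume.restrict ω)) (t : ℝ) {φ : Plane → ℝ} (hφ : IsTest ω φ) :
    curlDist ω (fun x => j x + t • k x) φ = curlDist ω j φ + t * curlDist ω k φ := by
  simp only [curlDist_eq_integral_inner, inner_add_left, real_inner_smul_left]
  rw [integral_add (integrable_curlDist hj hφ) ((integrable_curlDist hk hφ).const_mul t),
    integral_const_mul]

theorem curlDist_const_mul (j : Plane → Plane) (t : ℝ) {φ : Plane → ℝ} (hφ : IsTest ω φ) :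
    curlDist ω j (fun x => t * φ x) = t * curlDist ω j φ := by
  have h (i : Fin 2) (x : Plane) : pd2 i (fun y => t * φ y) x = t * pd2 i φ x := by
    simp only [pd2, fderiv_const_mul (hφ.differentiable x)]
    rfl
  simp only [curlDist, h]
  rw [← integral_const_mul]
  congr 1 with x
  ring

theorem radonNorm_le {T : (Plane → ℝ) → ℝ} {c : ℝ}
    (h : ∀ φ, IsTest ω φ → (∀ x, |φ x| ≤ 1) → T φ ≤ c) : radonNorm ω T ≤ ENNReal.ofReal c :=
  iSup₂_le fun φ hφ => ENNReal.ofReal_le_ofReal (h φ hφ.1 hφ.2)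

theorem le_toReal_radonNorm {T : (Plane → ℝ) → ℝ} (hT : radonNorm ω T ≠ ∞) {φ : Plane → ℝ}
    (hφ : IsTest ω φ) (h1 : ∀ x, |φ x| ≤ 1) : T φ ≤ (radonNorm ω T).toReal :=
  (ENNReal.ofReal_le_iff_le_toReal hT).1 (le_iSup₂_of_le φ ⟨hφ, h1⟩ le_rfl)

theorem lintegral_ofReal_mul_norm_sq {b : Plane → ℝ} (hω : MeasurableSet ω)
    (hb : ∀ x ∈ ω, 0 ≤ b x) {u : Plane → Plane}
    (hu : Integrable (fun x => b x * ‖u x‖ ^ 2) (volume.restrict ω)) :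
    ∫⁻ x in ω, ENNReal.ofReal (b x * ‖u x‖ ^ 2) =
      ENNReal.ofReal (∫ x in ω, b x * ‖u x‖ ^ 2) :=
  (ofReal_integral_eq_lintegral_ofReal hu
    (ae_restrict_of_forall_mem hω fun x hx => mul_nonneg (hb x hx) (sq_nonneg _))).symm

theorem nonneg_of_forall_small {c N : ℝ} (h : ∀ t : ℝ, 0 < t → t < 1 → 0 ≤ t * c + t ^ 2 * N) :
    0 ≤ c := by
  have ht : Tendsto (fun t : ℝ => c + t * N) (𝓝[>] 0) (𝓝 c) := by
    have : Tendsto (fun t : ℝ => c + t * N) (𝓝 0) (𝓝 (c + 0 * N)) := by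
      exact (continuous_const.add (continuous_id.mul continuous_const)).tendsto 0
    rw [zero_mul, add_zero] at this
    exact this.mono_left nhdsWithin_le_nhds
  refine ge_of_tendsto ht ?_
  filter_upwards [Ioo_mem_nhdsGT (zero_lt_one' ℝ)] with t ht
  have := h t ht.1 ht.2
  rw [show t * c + t ^ 2 * N = t * (c + t * N) by ring] at this
  exact nonneg_of_mul_nonneg_right this ht.1

theorem integrable_thickness_mul_norm_sq (hω : IsOpen ω) (hωb : Bornology.IsBounded ω)
    (hac : ContinuousOn (thickness f g) (closure ω)) {u : Plane → Plane}
    (hu : MemLp u 2 (volume.restrict ω)) :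
    Integrable (fun x => thickness f g x * ‖u x‖ ^ 2) (volume.restrict ω) :=
  integrable_mul_of_continuousOn_closure hω hωb hac hu.norm.integrable_sq

/-- The first-order condition at a minimizer `j`, in the direction of a current `k` along which
the total variation grows at most at the rate `s`. -/
theorem first_variation (hω : IsOpen ω) (hωb : Bornology.IsBounded ω)
    (hac : ContinuousOn (thickness f g) (closure ω))
    (hapos : ∀ x ∈ closure ω, 0 < thickness f g x)
    {B : Plane → Plane} (hB : MemLp B 2 (volume.restrict ω)) {j k : Plane → Plane} (hj : j ∈ Z ω f g) (hk : k ∈ Z ω f g)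
    (hj2 : MemLp j 2 (volume.restrict ω)) (hk2 : MemLp k 2 (volume.restrict ω))
    (hmin : ∀ k, meanField ω f g B j ≤ meanField ω f g B k)
    {r s : ℝ} (hr : 0 ≤ r)
    (hrj : radonNorm ω (fun φ => curlDist ω j (fun x => thickness f g x * φ x)) =
      ENNReal.ofReal r)
    (hs : ∀ t : ℝ, 0 < t → t < 1 → 0 ≤ r + t * s ∧ ∀ φ, IsTest ω φ → (∀ x, |φ x| ≤ 1) →
      curlDist ω (fun x => j x + t • k x) (fun x => thickness f g x * φ x) ≤ r + t * s) :
    0 ≤ s / 2 + ∫ x in ω, inner ℝ (thickness f g x • (j x - B x)) (k x) := by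
  set a := thickness f g with ha
  have hapos' : ∀ x ∈ ω, 0 ≤ a x := fun x hx => (hapos x (subset_closure hx)).le
  have hjB : MemLp (fun x => j x - B x) 2 (volume.restrict ω) := hj2.sub hB
  have hQj := integrable_thickness_mul_norm_sq hω hωb hac hjB
  have hQk := integrable_thickness_mul_norm_sq hω hωb hac hk2
  have hP : Integrable (fun x => inner ℝ (a x • (j x - B x)) (k x)) (volume.restrict ω) :=
    integrable_inner_of_memLp (memLp_smul_of_continuousOn_closure hω hωb hac hjB) hk2
  set P := ∫ x in ω, inner ℝ (a x • (j x - B x)) (k x)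
  set N := ∫ x in ω, a x * ‖k x‖ ^ 2
  refine nonneg_of_forall_small (N := N / 2) fun t ht0 ht1 => ?_
  have hjt : (fun x => j x + t • k x) ∈ Z ω f g := Z_add hj (Z_smul hk t)
  have hQt : Integrable (fun x => a x * ‖j x + t • k x - B x‖ ^ 2) (volume.restrict ω) :=
    integrable_thickness_mul_norm_sq hω hωb hac ((hj2.add (hk2.const_smul t)).sub hB)
  have hexp : ∫ x in ω, a x * ‖j x + t • k x - B x‖ ^ 2 =
      (∫ x in ω, a x * ‖j x - B x‖ ^ 2) + 2 * t * P + t ^ 2 * N := by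
    have hpt : ∀ x, a x * ‖j x + t • k x - B x‖ ^ 2 = a x * ‖j x - B x‖ ^ 2 +
        2 * t * inner ℝ (a x • (j x - B x)) (k x) + t ^ 2 * (a x * ‖k x‖ ^ 2) := by
      intro x
      rw [show j x + t • k x - B x = (j x - B x) + t • k x by abel, norm_add_sq_real,
        real_inner_smul_right, real_inner_smul_left, norm_smul, mul_pow, Real.norm_eq_abs, sq_abs]
      ring
    have hjP : Integrable (fun x => a x * ‖j x - B x‖ ^ 2 +
        2 * t * inner ℝ (a x • (j x - B x)) (k x)) (volume.restrict ω) :=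
      hQj.add (hP.const_mul _)
    simp only [hpt]
    rw [integral_add hjP (hQk.const_mul _),
      integral_add hQj (hP.const_mul _), integral_const_mul, integral_const_mul]
  have h := hmin (fun x => j x + t • k x)
  obtain ⟨hrt, hst⟩ := hs t ht0 ht1
  simp only [meanField, if_pos hj, if_pos hjt] at h
  rw [hrj, lintegral_ofReal_mul_norm_sq hω.measurableSet hapos' hQj,
    lintegral_ofReal_mul_norm_sq hω.measurableSet hapos' hQt] at h
  have hQj0 : 0 ≤ ∫ x in ω, a x * ‖j x - B x‖ ^ 2 :=
    setIntegral_nonneg hω.measurableSet fun x hx => mul_nonneg (hapos' x hx) (sq_nonneg _)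
  have hQt0 : 0 ≤ ∫ x in ω, a x * ‖j x + t • k x - B x‖ ^ 2 :=
    setIntegral_nonneg hω.measurableSet fun x hx => mul_nonneg (hapos' x hx) (sq_nonneg _)
  have h' : (1 / 2 : ℝ≥0∞) * ENNReal.ofReal r +
      1 / 2 * ENNReal.ofReal (∫ x in ω, a x * ‖j x - B x‖ ^ 2) ≤
      1 / 2 * ENNReal.ofReal (r + t * s) +
      1 / 2 * ENNReal.ofReal (∫ x in ω, a x * ‖j x + t • k x - B x‖ ^ 2) :=
    h.trans (by gcongr; exact radonNorm_le hst)
  rw [show (1 / 2 : ℝ≥0∞) = ENNReal.ofReal (1 / 2) by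
      rw [ENNReal.ofReal_div_of_pos two_pos]; simp,
    ← ENNReal.ofReal_mul (by norm_num), ← ENNReal.ofReal_mul (by norm_num),
    ← ENNReal.ofReal_mul (by norm_num), ← ENNReal.ofReal_mul (by norm_num),
    ← ENNReal.ofReal_add (by positivity) (by positivity),
    ← ENNReal.ofReal_add (by positivity) (by positivity),
    ENNReal.ofReal_le_ofReal_iff (by positivity), hexp] at h'
  linarith

theorem zero_mem_Z (hω : IsOpen ω) (hωb : Bornology.IsBounded ω)
    (hf : ∀ x ∈ closure ω, ContinuousAt f x) (hg : ∀ x ∈ closure ω, ContinuousAt g x) :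
    (fun _ => 0) ∈ Z ω f g :=
  mem_Z_of_curlDist hω hωb hf hg MemLp.zero' MeasurableSet.empty (Set.empty_subset ω)
    fun φ _ => by simp [curlDist]

/-- A minimizer has finite energy, since the zero current has: hence it is square-integrable on
`ω` and the total variation of its weighted curl is finite. -/
theorem memLp_and_radonNorm_ne_top (hω : IsOpen ω) (hωb : Bornology.IsBounded ω)
    (hf : ∀ x ∈ closure ω, ContinuousAt f x) (hg : ∀ x ∈ closure ω, ContinuousAt g x)
    (hapos : ∀ x ∈ closure ω, 0 < thickness f g x)
    {B : Plane → Plane} (hB : MemLp B 2 (volume.restrict ω)) {j : Plane → Plane}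
    (hj : j ∈ Z ω f g) (hmin : ∀ k, meanField ω f g B j ≤ meanField ω f g B k) :
    MemLp j 2 (volume.restrict ω) ∧
      radonNorm ω (fun φ => curlDist ω j (fun x => thickness f g x * φ x)) ≠ ∞ := by
  have hac : ContinuousOn (thickness f g) (closure ω) := fun x hx =>
    ((hg x hx).sub (hf x hx)).continuousWithinAt
  have hfin : meanField ω f g B j < ∞ := by
    refine (hmin fun _ => 0).trans_lt ?_
    have hB' : MemLp (fun x => (0 : Plane) - B x) 2 (volume.restrict ω) := by
      simp only [zero_sub]
      exact hB.neg
    have hQ := integrable_thickness_mul_norm_sq hω hωb hac hB'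
    have h0 : radonNorm ω (fun φ => curlDist ω (fun _ => 0)
        (fun x => thickness f g x * φ x)) ≤ ENNReal.ofReal 0 :=
      radonNorm_le fun φ _ _ => by simp [curlDist]
    rw [meanField, if_pos (zero_mem_Z hω hωb hf hg)]
    refine ENNReal.add_lt_top.2 ⟨ENNReal.mul_lt_top (by simp) (h0.trans_lt (by simp)),
      ENNReal.mul_lt_top (by simp) ?_⟩
    have := lintegral_ofReal_mul_norm_sq hω.measurableSet
      (fun x hx => (hapos x (subset_closure hx)).le) hQ
    exact this.trans_lt ENNReal.ofReal_lt_top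
  rw [meanField, if_pos hj, ENNReal.add_lt_top] at hfin
  obtain ⟨h1, h2⟩ := hfin
  have hhalf : (1 / 2 : ℝ≥0∞) ≠ 0 := by simp
  refine ⟨?_, fun h => by rw [h, ENNReal.mul_top hhalf] at h1; exact lt_irrefl _ h1⟩
  have h3 : ∫⁻ x in ω, ENNReal.ofReal (thickness f g x * ‖j x - B x‖ ^ 2) < ∞ := by
    refine lt_top_iff_ne_top.2 fun h => ?_
    rw [h, ENNReal.mul_top hhalf] at h2
    exact lt_irrefl _ h2
  have hjBm : AEStronglyMeasurable (fun x => j x - B x) (volume.restrict ω) := hj.1.sub hB.1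
  have ham : AEStronglyMeasurable (thickness f g) (volume.restrict ω) :=
    (hac.mono subset_closure).aestronglyMeasurable hω.measurableSet
  have hi : Integrable (fun x => thickness f g x * ‖j x - B x‖ ^ 2) (volume.restrict ω) := by
    refine ⟨ham.mul (hjBm.norm.pow 2), ?_⟩
    rw [hasFiniteIntegral_iff_ofReal (ae_restrict_of_forall_mem hω.measurableSet fun x hx =>
      mul_nonneg (hapos x (subset_closure hx)).le (sq_nonneg _))]
    exact h3
  have hinv : ContinuousOn (fun x => (thickness f g x)⁻¹) (closure ω) :=
    hac.inv₀ fun x hx => (hapos x hx).ne'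
  have hi2 : Integrable (fun x => ‖j x - B x‖ ^ 2) (volume.restrict ω) := by
    refine (integrable_mul_of_continuousOn_closure hω hωb hinv hi).congr
      (ae_restrict_of_forall_mem hω.measurableSet fun x hx => ?_)
    exact inv_mul_cancel_left₀ (hapos x (subset_closure hx)).ne' _
  have h4 : MemLp (fun x => j x - B x) 2 (volume.restrict ω) :=
    (memLp_two_iff_integrable_sq_norm hjBm).2 hi2
  exact (h4.add hB).ae_eq (Eventually.of_forall fun x => sub_add_cancel (j x) (B x))

end Variation
/-! ### Truncation of admissible functions -/

section Truncation

/-- A smooth truncation: the identity near `[-1/2, 1/2]`, bounded by a given `c > 1/2`. -/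
theorem exists_truncation {c : ℝ} (hc : 1 / 2 < c) :
    ∃ T : ℝ → ℝ, ContDiff ℝ (⊤ : ℕ∞) T ∧ HasCompactSupport T ∧ (∀ s, |T s| ≤ c) ∧
      ∀ s, |s| ≤ 1 / 2 → T s = s ∧ deriv T s = 1 := by
  let b : ContDiffBump (0 : ℝ) :=
    { rIn := (1 / 2 + c) / 2, rOut := c, rIn_pos := by linarith, rIn_lt_rOut := by linarith }
  refine ⟨fun s => s * b s, contDiff_id.mul b.contDiff, b.hasCompactSupport.mul_left,
    fun s => ?_, fun s hs => ?_⟩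
  · rw [abs_mul, abs_of_nonneg b.nonneg]
    by_cases h : |s| < c
    · exact (mul_le_mul h.le b.le_one b.nonneg (by linarith)).trans (mul_one c).le
    · rw [b.zero_of_le_dist (by simpa using not_lt.1 h), mul_zero]
      linarith
  · have hball : s ∈ Metric.ball (0 : ℝ) b.rIn := by
      rw [mem_ball_zero_iff, Real.norm_eq_abs]
      change |s| < (1 / 2 + c) / 2
      linarith
    have hev : (fun s => s * b s) =ᶠ[𝓝 s] fun s => s := by
      filter_upwards [b.eventuallyEq_one_of_mem_ball hball] with y hy
      simp [hy]
    exact ⟨hev.eq_of_nhds, by rw [hev.deriv_eq]; exact deriv_id s⟩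

variable {ω : Set Plane}

/-- The gradient of `a T(φ / a)`, written without derivatives of `1 / a`. -/
theorem grad2_truncation {a φ u : Plane → ℝ} {T : ℝ → ℝ} (hT : Differentiable ℝ T) {x : Plane}
    (ha : DifferentiableAt ℝ a x) (hu : DifferentiableAt ℝ u x)
    (hφ : φ =ᶠ[𝓝 x] fun y => a y * u y) :
    grad2 (fun y => a y * T (u y)) x =
      (T (u x) - u x * deriv T (u x)) • grad2 a x + deriv T (u x) • grad2 φ x := by
  ext i
  have h1 : pd2 i φ x = a x * pd2 i u x + u x * pd2 i a x := by
    rw [pd2, hφ.fderiv_eq, fderiv_fun_mul ha hu]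
    rfl
  have h2 : HasFDerivAt (fun y => T (u y)) (deriv T (u x) • fderiv ℝ u x) x :=
    (hT (u x)).hasDerivAt.comp_hasFDerivAt x hu.hasFDerivAt
  have h3 : pd2 i (fun y => a y * T (u y)) x =
      a x * (deriv T (u x) * pd2 i u x) + T (u x) * pd2 i a x := by
    rw [pd2, fderiv_fun_mul ha h2.differentiableAt, h2.fderiv]
    rfl
  simp only [grad2_apply, PiLp.add_apply, PiLp.smul_apply, smul_eq_mul, h1, h3]
  ring

/-- The obstacle condition `|ξ| ≤ a / 2` bounds the pairing of `∇ × j` with `ξ ∈ H¹₀(ω)` by half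
of the total variation of `a ∇ × j`. -/
theorem integral_inner_perp_le (hω : IsOpen ω) (hωb : Bornology.IsBounded ω)
    {a : Plane → ℝ} (ha : ∀ x ∈ closure ω, ContDiffAt ℝ (⊤ : ℕ∞) a x)
    (hapos : ∀ x ∈ closure ω, 0 < a x) {j : Plane → Plane} (hj : MemLp j 2 (volume.restrict ω))
    {r : ℝ}
    (hr : ∀ φ, IsTest ω φ → (∀ x, |φ x| ≤ 1) → curlDist ω j (fun x => a x * φ x) ≤ r)
    {ξ : Plane → ℝ} {X : Plane → Plane} (hξ : IsAdmissible ω a ξ X) :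
    ∫ x in ω, inner ℝ (j x) (perp (X x)) ≤ r / 2 := by
  set ν := (volume : Measure Plane).restrict ω with hν
  obtain ⟨⟨hξ2, hX, -, φ, hφ, hφξ, hφX⟩, hξa⟩ := hξ
  have ha' : ∀ x ∈ ω, ContDiffAt ℝ (⊤ : ℕ∞) a x := fun x hx => ha x (subset_closure hx)
  have ha0 : ∀ x ∈ ω, 0 < a x := fun x hx => hapos x (subset_closure hx)
  have hac : ContinuousOn a (closure ω) := fun x hx => (ha x hx).continuousAt.continuousWithinAt
  -- it suffices to bound the pairing by `c r` for every `c > 1 / 2`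
  suffices key : ∀ c : ℝ, 1 / 2 < c → ∫ x in ω, inner ℝ (j x) (perp (X x)) ≤ c * r by
    have ht : Tendsto (fun c : ℝ => c * r) (𝓝[>] (1 / 2)) (𝓝 (1 / 2 * r)) :=
      ((continuous_id.mul continuous_const).tendsto _).mono_left nhdsWithin_le_nhds
    have := ge_of_tendsto ht (eventually_nhdsWithin_of_forall fun c hc => key c hc)
    linarith
  intro c hc
  obtain ⟨T, hT, hTs, hTc, hTid⟩ := exists_truncation hc
  have hTd : Differentiable ℝ T := hT.differentiable (by simp)
  have hT' : Continuous (deriv T) := hT.continuous_deriv (by simp)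
  obtain ⟨C₂, hC₂⟩ := hTs.deriv.exists_bound_of_continuous hT'
  -- the factor of `∇a` in `∇(a T(u))`; it vanishes on `[-1/2, 1/2]`
  set h : ℝ → ℝ := fun s => T s - s * deriv T s with hh
  have hhc : Continuous h := hT.continuous.sub (continuous_id.mul hT')
  obtain ⟨C₁, hC₁⟩ := (hTs.sub hTs.deriv.mul_left).exists_bound_of_continuous hhc
  have hT0 : T 0 = 0 := (hTid 0 (by norm_num)).1
  have hinv : ∀ x ∈ ω, ContDiffAt ℝ (⊤ : ℕ∞) (fun y => (a y)⁻¹) x := fun x hx =>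
    (ha' x hx).inv (ha0 x hx).ne'
  set u : ℕ → Plane → ℝ := fun n x => (a x)⁻¹ * φ n x with hu
  have hut (n : ℕ) : IsTest ω (u n) := (hφ n).mul_left hinv
  have hgrad (n : ℕ) : ∀ x ∈ ω, grad2 (fun y => a y * T (u n y)) x =
      h (u n x) • grad2 a x + deriv T (u n x) • grad2 (φ n) x := by
    intro x hx
    refine grad2_truncation hTd ((ha' x hx).differentiableAt (by simp))
      ((hut n).differentiable x) ?_
    filter_upwards [hω.mem_nhds hx] with y hy
    exact (mul_inv_cancel_left₀ (ha0 y hy).ne' _).symm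
  have hbound (n : ℕ) : curlDist ω j (fun y => a y * T (u n y)) ≤ c * r := by
    have hc0 : 0 < c := by linarith
    have htest : IsTest ω fun y => c⁻¹ * T (u n y) :=
      ((hut n).comp_left hT hT0).const_mul c⁻¹
    have h1 := hr _ htest fun x => by
      rw [abs_mul, abs_of_pos (inv_pos.2 hc0)]
      exact (mul_le_mul_of_nonneg_left (hTc _) (inv_pos.2 hc0).le).trans
        (inv_mul_cancel₀ hc0.ne').le
    have h2 := curlDist_const_mul j c (htest.mul_left ha')
    have h3 : (fun x => c * (a x * (c⁻¹ * T (u n x)))) = fun y => a y * T (u n y) := by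
      funext x
      field_simp
    rw [h3] at h2
    rw [h2]
    exact mul_le_mul_of_nonneg_left h1 hc0.le
  -- almost everywhere convergence along a subsequence
  have hmeas := tendstoInMeasure_of_tendsto_eLpNorm (by norm_num)
    (fun n => ((hφ n).memLp ν 2).1) hξ2.1 hφξ
  obtain ⟨ns, hns, hae⟩ := hmeas.exists_seq_tendsto_ae
  have hgm : MemLp (grad2 a) 2 ν := by
    refine MemLp.of_eval_piLp fun i => ?_
    simp only [grad2_apply]
    exact memLp_of_continuousOn_closure hω hωb
      (fun x hx => (continuousAt_pd2 (ha x hx) i).continuousWithinAt) 2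
  set p : Plane → ℝ := fun x => inner ℝ (j x) (perp (grad2 a x))
  set q : Plane → ℝ := fun x => inner ℝ (j x) (perp (X x))
  have hp : Integrable p ν := integrable_inner_of_memLp hj (memLp_perp hgm)
  have hq : Integrable q ν := integrable_inner_of_memLp hj (memLp_perp hX)
  set d : ℕ → Plane → ℝ := fun n x => inner ℝ (j x) (perp (grad2 (φ n) x - X x))
  have hdm (n : ℕ) : MemLp (fun x => grad2 (φ n) x - X x) 2 ν :=
    ((hφ n).memLp_grad2 ν 2).sub hX
  have hd (n : ℕ) : Integrable (d n) ν := integrable_inner_of_memLp hj (memLp_perp (hdm n))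
  have hd0 : Tendsto (fun n => C₂ * ∫ x, ‖j x‖ * ‖grad2 (φ n) x - X x‖ ∂ν) atTop (𝓝 0) := by
    have := tendsto_integral_inner (F := fun n x => ‖grad2 (φ n) x - X x‖) (f := fun _ => (0 : ℝ))
      hj.norm (fun n => (hdm n).norm) MemLp.zero' (by simpa using hφX)
    simp only [Real.inner_apply, mul_zero, integral_zero] at this
    simpa [mul_comm] using this.const_mul C₂
  have hum (n : ℕ) : Continuous (u n) := (hut n).continuous
  have hlim1 : Tendsto (fun n => ∫ x, h (u (ns n) x) * p x + deriv T (u (ns n) x) * q x ∂ν)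
      atTop (𝓝 (∫ x, q x ∂ν)) := by
    refine tendsto_integral_of_dominated_convergence (fun x => C₁ * ‖p x‖ + C₂ * ‖q x‖)
      (fun n => ((hhc.comp (hum _)).aestronglyMeasurable.mul hp.1).add
        ((hT'.comp (hum _)).aestronglyMeasurable.mul hq.1))
      ((hp.norm.const_mul _).add (hq.norm.const_mul _))
      (fun n => Eventually.of_forall fun x => ?_) ?_
    · refine (norm_add_le _ _).trans ?_
      rw [norm_mul, norm_mul]
      gcongr
      · exact hC₁ _
      · exact hC₂ _
    · filter_upwards [hae, hξa, ae_restrict_mem hω.measurableSet] with x hx hxa hxω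
      have hlim : Tendsto (fun n => u (ns n) x) atTop (𝓝 ((a x)⁻¹ * ξ x)) := hx.const_mul _
      have hle : |(a x)⁻¹ * ξ x| ≤ 1 / 2 := by
        rw [abs_mul, abs_of_pos (inv_pos.2 (ha0 x hxω)), inv_mul_le_iff₀ (ha0 x hxω)]
        linarith
      obtain ⟨e1, e2⟩ := hTid _ hle
      have l1 := ((hhc.tendsto _).comp hlim).mul_const (p x)
      have l2 := ((hT'.tendsto _).comp hlim).mul_const (q x)
      have l3 := l1.add l2
      simp only [hh, e1, e2, mul_one, sub_self, zero_mul, one_mul, zero_add] at l3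
      exact l3
  have hlim2 : Tendsto (fun n => ∫ x, deriv T (u (ns n) x) * d (ns n) x ∂ν) atTop (𝓝 0) := by
    refine squeeze_zero_norm (fun n => ?_) (hd0.comp hns.tendsto_atTop)
    rw [Function.comp_apply, ← integral_const_mul]
    refine norm_integral_le_of_norm_le
      ((hj.norm.integrable_mul (hdm (ns n)).norm).const_mul C₂) (Eventually.of_forall fun x => ?_)
    rw [norm_mul]
    refine mul_le_mul (hC₂ _) ((norm_inner_le_norm _ _).trans_eq ?_) (norm_nonneg _)
      ((norm_nonneg _).trans (hC₂ 0))
    rw [norm_perp]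
  have hsum := hlim1.add hlim2
  rw [add_zero] at hsum
  refine le_of_tendsto hsum (Eventually.of_forall fun n => ?_)
  refine le_trans (le_of_eq ?_) (hbound (ns n))
  have i1 : Integrable (fun x => h (u (ns n) x) * p x + deriv T (u (ns n) x) * q x) ν :=
    (hp.bdd_mul (hhc.comp (hum _)).aestronglyMeasurable
      (Eventually.of_forall fun x => hC₁ _)).add
    (hq.bdd_mul (hT'.comp (hum _)).aestronglyMeasurable
      (Eventually.of_forall fun x => hC₂ _))
  have i2 : Integrable (fun x => deriv T (u (ns n) x) * d (ns n) x) ν :=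
    (hd _).bdd_mul (hT'.comp (hum _)).aestronglyMeasurable
      (Eventually.of_forall fun x => hC₂ _)
  rw [curlDist_eq_integral_inner, ← integral_add i1 i2]
  refine setIntegral_congr_fun hω.measurableSet fun x hx => ?_
  simp only [p, q, d]
  rw [hgrad _ x hx, perp_add, perp_smul, perp_smul, perp_sub, inner_add_right, inner_sub_right,
    real_inner_smul_right, real_inner_smul_right]
  ring

end Truncation
/-! ### Energies of admissible functions -/

section Energy

variable {ω : Set Plane}

/-- Convexity of the energy: its increment is bounded below by its differential, written here for
a function `ζ` whose rotated gradient is `a (B - j)`. -/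
theorem obstacleEnergy_le (hω : IsOpen ω) (hωb : Bornology.IsBounded ω) {a F : Plane → ℝ}
    (ha : ContinuousOn a (closure ω)) (hapos : ∀ x ∈ closure ω, 0 < a x)
    (hF : ContinuousOn F (closure ω)) {B j : Plane → Plane} (hB : MemLp B 2 (volume.restrict ω))
    (hcurl : ∀ φ, IsTest ω φ → curlDist ω B φ = ∫ x in ω, F x * φ x)
    (hj : MemLp j 2 (volume.restrict ω)) {ζ ξ : Plane → ℝ} {G X : Plane → Plane}
    (hζ : IsH10 ω ζ G) (hξ : IsH10 ω ξ X) (hG : ∀ x, perp (G x) = a x • (B x - j x))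
    (hle : ∫ x in ω, inner ℝ (j x) (perp (X x)) ≤ ∫ x in ω, inner ℝ (j x) (perp (G x))) :
    obstacleEnergy ω a F ζ G ≤ obstacleEnergy ω a F ξ X := by
  set ν := (volume : Measure Plane).restrict ω
  have hFm : MemLp F 2 ν := memLp_of_continuousOn_closure hω hωb hF 2
  have hc : ContinuousOn (fun x => 1 / (2 * a x)) (closure ω) :=
    continuousOn_const.div (continuousOn_const.mul ha) fun x hx => by
      have := hapos x hx
      positivity
  have henergy {u : Plane → ℝ} {U : Plane → Plane} (hu : IsH10 ω u U) :
      Integrable (fun x => 1 / (2 * a x) * ‖U x‖ ^ 2 - F x * u x) ν :=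
    (integrable_mul_of_continuousOn_closure hω hωb hc hu.memLp_grad.norm.integrable_sq).sub
      (hFm.integrable_mul hu.memLp)
  have hpair {k U : Plane → Plane} (hk : MemLp k 2 ν) (hU : MemLp U 2 ν) :
      Integrable (fun x => inner ℝ (k x) (perp (U x))) ν :=
    integrable_inner_of_memLp hk (memLp_perp hU)
  have hdiff {u : Plane → ℝ} {U : Plane → Plane} (hu : IsH10 ω u U) :
      Integrable (fun x => inner ℝ (B x) (perp (U x)) - inner ℝ (j x) (perp (U x)) - F x * u x) ν :=
    ((hpair hB hu.memLp_grad).sub (hpair hj hu.memLp_grad)).sub (hFm.integrable_mul hu.memLp)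
  have hval {u : Plane → ℝ} {U : Plane → Plane} (hu : IsH10 ω u U) :
      ∫ x, (inner ℝ (B x) (perp (U x)) - inner ℝ (j x) (perp (U x)) - F x * u x) ∂ν =
        -∫ x, inner ℝ (j x) (perp (U x)) ∂ν := by
    have h1 : Integrable (fun x => inner ℝ (B x) (perp (U x)) - inner ℝ (j x) (perp (U x))) ν :=
      (hpair hB hu.memLp_grad).sub (hpair hj hu.memLp_grad)
    have h2 : Integrable (fun x => F x * u x) ν := hFm.integrable_mul hu.memLp
    rw [integral_sub h1 h2, integral_sub (hpair hB hu.memLp_grad) (hpair hj hu.memLp_grad),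
      hu.integral_inner_perp hB hFm hcurl]
    ring
  have hmono : ∫ x, (inner ℝ (B x) (perp (X x)) - inner ℝ (j x) (perp (X x)) - F x * ξ x) -
        (inner ℝ (B x) (perp (G x)) - inner ℝ (j x) (perp (G x)) - F x * ζ x) ∂ν ≤
      ∫ x, (1 / (2 * a x) * ‖X x‖ ^ 2 - F x * ξ x) -
        (1 / (2 * a x) * ‖G x‖ ^ 2 - F x * ζ x) ∂ν := by
    refine integral_mono_ae ((hdiff hξ).sub (hdiff hζ)) ((henergy hξ).sub (henergy hζ))
      (ae_restrict_of_forall_mem hω.measurableSet fun x hx => ?_)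
    have ha0 := hapos x (subset_closure hx)
    -- `(B - j) · ∇^⊥(ξ - ζ) = (1 / a) ∇ζ · ∇(ξ - ζ)`
    have h1 : inner ℝ (B x) (perp (X x)) - inner ℝ (j x) (perp (X x)) =
        (1 / a x) * inner ℝ (G x) (X x) := by
      rw [← inner_sub_left, ← inner_perp_perp (G x), hG, real_inner_smul_left]
      field_simp
    have h2 : inner ℝ (B x) (perp (G x)) - inner ℝ (j x) (perp (G x)) =
        (1 / a x) * ‖G x‖ ^ 2 := by
      rw [← inner_sub_left, ← real_inner_self_eq_norm_sq, ← inner_perp_perp (G x) (G x)]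
      nth_rw 2 [hG]
      rw [real_inner_smul_left]
      field_simp
    have h3 : 0 ≤ 1 / (2 * a x) * ‖X x - G x‖ ^ 2 := by positivity
    rw [norm_sub_sq_real, real_inner_comm] at h3
    have h4 : 1 / a x = 2 * (1 / (2 * a x)) := by field_simp
    simp only [h1, h2, h4]
    nlinarith [h3]
  rw [integral_sub (hdiff hξ) (hdiff hζ), integral_sub (henergy hξ) (henergy hζ), hval hξ,
    hval hζ] at hmono
  unfold obstacleEnergy
  linarith

theorem continuousAt_effectiveField (H : Vec3) {f g : Plane → ℝ} {x : Plane}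
    (hf : ContDiffAt ℝ (⊤ : ℕ∞) f x) (hg : ContDiffAt ℝ (⊤ : ℕ∞) g x) :
    ContinuousAt (effectiveField H f g) x := by
  have h (i : Fin 2) : ContinuousAt (pd2 i fun y => (f y + g y) / 2) x :=
    continuousAt_pd2 ((hf.add hg).div_const 2) i
  exact continuousAt_const.sub ((continuousAt_const.mul (h 0)).add (continuousAt_const.mul (h 1)))

end Energy

/-! ### Optimality conditions at a minimizer -/

section Optimality

variable {ω : Set Plane} {f g : Plane → ℝ}

/-- Perturbation of a minimizer by `c = ± 1` times a current whose curl is the indicator function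
of a set `A`. -/
theorem variation_indicator (hω : IsOpen ω) (hωb : Bornology.IsBounded ω)
    (hf : ∀ x ∈ closure ω, ContDiffAt ℝ (⊤ : ℕ∞) f x)
    (hg : ∀ x ∈ closure ω, ContDiffAt ℝ (⊤ : ℕ∞) g x)
    (hapos : ∀ x ∈ closure ω, 0 < thickness f g x)
    {B : Plane → Plane} (hB : MemLp B 2 (volume.restrict ω)) {j : Plane → Plane}
    (hj : j ∈ Z ω f g) (hj2 : MemLp j 2 (volume.restrict ω))
    (hmin : ∀ k, meanField ω f g B j ≤ meanField ω f g B k) {r : ℝ} (hr : 0 ≤ r)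
    (hrj : radonNorm ω (fun φ => curlDist ω j (fun x => thickness f g x * φ x)) =
      ENNReal.ofReal r)
    (hjr : ∀ φ, IsTest ω φ → (∀ x, |φ x| ≤ 1) →
      curlDist ω j (fun x => thickness f g x * φ x) ≤ r)
    {k : Plane → Plane} (hk : MemLp k 2 (volume.restrict ω)) {A : Set Plane}
    (hA : MeasurableSet A) (hAω : A ⊆ ω)
    (hkA : ∀ φ, IsTest ω φ → curlDist ω k φ = ∫ x in A, φ x) {c : ℝ} (hc : |c| = 1) :
    0 ≤ (∫ x in A, thickness f g x) / 2 +
      c * ∫ x in ω, inner ℝ (thickness f g x • (j x - B x)) (k x) := by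
  have hac : ContinuousOn (thickness f g) (closure ω) := fun x hx =>
    ((hg x hx).continuousAt.sub (hf x hx).continuousAt).continuousWithinAt
  have hkZ := mem_Z_of_curlDist hω hωb (fun x hx => (hf x hx).continuousAt)
    (fun x hx => (hg x hx).continuousAt) hk hA hAω hkA
  have hai : Integrable (thickness f g) (volume.restrict ω) :=
    memLp_one_iff_integrable.1 (memLp_of_continuousOn_closure hω hωb hac 1)
  have haA : IntegrableOn (thickness f g) A := IntegrableOn.mono_set hai hAω
  have hA0 : 0 ≤ ∫ x in A, thickness f g x :=
    setIntegral_nonneg hA fun x hx => (hapos x (subset_closure (hAω hx))).le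
  have hck : MemLp (fun x => c • k x) 2 (volume.restrict ω) := hk.const_smul c
  have h := first_variation hω hωb hac hapos hB hj (Z_smul hkZ c) hj2 hck hmin
    hr hrj (s := ∫ x in A, thickness f g x) fun t ht0 _ => ⟨by positivity, fun φ hφ h1 => ?_⟩
  · simpa only [real_inner_smul_right, integral_const_mul] using h
  · have haφ : IsTest ω fun x => thickness f g x * φ x :=
      hφ.mul_left fun x hx => (hg x (subset_closure hx)).sub (hf x (subset_closure hx))
    have hφa : IntegrableOn (fun x => thickness f g x * φ x) A :=
      (memLp_one_iff_integrable.1 (haφ.memLp volume 1)).integrableOn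
    have h2 : c * ∫ x in A, thickness f g x * φ x ≤ ∫ x in A, thickness f g x := by
      rw [← integral_const_mul]
      refine setIntegral_mono_on (hφa.const_mul c) haA hA fun x hx => ?_
      have h3 : c * φ x ≤ 1 := by
        refine (le_abs_self _).trans ?_
        rw [abs_mul, hc, one_mul]
        exact h1 x
      have h4 := hapos x (subset_closure (hAω hx))
      nlinarith
    have h5 : curlDist ω (fun x => c • k x) (fun x => thickness f g x * φ x) =
        c * ∫ x in A, thickness f g x * φ x := by
      rw [← hkA _ haφ]
      simp only [curlDist_eq_integral_inner, real_inner_smul_left, integral_const_mul]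
    rw [curlDist_add_smul hj2 hck t haφ, h5]
    have := hjr φ hφ h1
    nlinarith

/-- Scaling a minimizer `j` towards zero decreases the total variation of its weighted curl at
the rate `r`. -/
theorem variation_scaling (hω : IsOpen ω) (hωb : Bornology.IsBounded ω)
    (hf : ∀ x ∈ closure ω, ContDiffAt ℝ (⊤ : ℕ∞) f x)
    (hg : ∀ x ∈ closure ω, ContDiffAt ℝ (⊤ : ℕ∞) g x)
    (hapos : ∀ x ∈ closure ω, 0 < thickness f g x)
    {B : Plane → Plane} (hB : MemLp B 2 (volume.restrict ω)) {j : Plane → Plane}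
    (hj : j ∈ Z ω f g) (hj2 : MemLp j 2 (volume.restrict ω))
    (hmin : ∀ k, meanField ω f g B j ≤ meanField ω f g B k) {r : ℝ} (hr : 0 ≤ r)
    (hrj : radonNorm ω (fun φ => curlDist ω j (fun x => thickness f g x * φ x)) =
      ENNReal.ofReal r)
    (hjr : ∀ φ, IsTest ω φ → (∀ x, |φ x| ≤ 1) →
      curlDist ω j (fun x => thickness f g x * φ x) ≤ r) :
    r / 2 ≤ -∫ x in ω, inner ℝ (thickness f g x • (j x - B x)) (j x) := by
  have hac : ContinuousOn (thickness f g) (closure ω) := fun x hx =>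
    ((hg x hx).continuousAt.sub (hf x hx).continuousAt).continuousWithinAt
  have hk : MemLp (fun x => (-1 : ℝ) • j x) 2 (volume.restrict ω) := hj2.const_smul (-1 : ℝ)
  have h := first_variation hω hωb hac hapos hB hj (Z_smul hj (-1)) hj2 hk hmin
    hr hrj (s := -r) fun t ht0 ht1 => ⟨by nlinarith, fun φ hφ h1 => ?_⟩
  · simp only [real_inner_smul_right, integral_const_mul] at h
    linarith
  · have haφ : IsTest ω fun x => thickness f g x * φ x :=
      hφ.mul_left fun x hx => (hg x (subset_closure hx)).sub (hf x (subset_closure hx))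
    have h5 : curlDist ω (fun x => (-1 : ℝ) • j x) (fun x => thickness f g x * φ x) =
        -1 * curlDist ω j (fun x => thickness f g x * φ x) := by
      simp only [curlDist_eq_integral_inner, real_inner_smul_left, integral_const_mul]
    rw [curlDist_add_smul hj2 hk t haφ, h5]
    have := hjr φ hφ h1
    nlinarith

end Optimality

end ThinFilm

end

open ThinFilm

theorem proposition1p3
    (ω : Set ThinFilm.Plane) (hω : IsOpen ω) (hωb : Bornology.IsBounded ω)
    (f g : ThinFilm.Plane → ℝ)
    (hf : ∀ x ∈ closure ω, ContDiffAt ℝ (⊤ : ℕ∞) f x)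
    (hg : ∀ x ∈ closure ω, ContDiffAt ℝ (⊤ : ℕ∞) g x)
    (hfg : ∀ x ∈ closure ω, f x < g x)
    (H : ThinFilm.Vec3)
    (B : ThinFilm.Plane → ThinFilm.Plane)
    (hB : MemLp B 2 (volume.restrict ω))
    (hcurl : ∀ φ : ThinFilm.Plane → ℝ, ThinFilm.IsTest ω φ →
      ThinFilm.curlDist ω B φ = ∫ x in ω, ThinFilm.effectiveField H f g x * φ x)
    (j : ThinFilm.Plane → ThinFilm.Plane)
    (hj : j ∈ ThinFilm.Z ω f g)
    (hmin : ∀ k : ThinFilm.Plane → ThinFilm.Plane,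
      ThinFilm.meanField ω f g B j ≤ ThinFilm.meanField ω f g B k) :
    ∃ (ζ : ThinFilm.Plane → ℝ) (G : ThinFilm.Plane → ThinFilm.Plane),
      ThinFilm.SolvesObstacleProblem ω (ThinFilm.thickness f g)
        (ThinFilm.effectiveField H f g) ζ G ∧
      ∀ᵐ x ∂(volume.restrict ω),
        j x = B x - (1 / ThinFilm.thickness f g x) • ThinFilm.perp (G x) := by
  have hfc : ∀ x ∈ closure ω, ContinuousAt f x := fun x hx => (hf x hx).continuousAt
  have hgc : ∀ x ∈ closure ω, ContinuousAt g x := fun x hx => (hg x hx).continuousAt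
  set a := thickness f g with ha
  have has : ∀ x ∈ closure ω, ContDiffAt ℝ (⊤ : ℕ∞) a x := fun x hx => (hg x hx).sub (hf x hx)
  have hac : ContinuousOn a (closure ω) := fun x hx => (has x hx).continuousAt.continuousWithinAt
  have hapos : ∀ x ∈ closure ω, 0 < a x := fun x hx => sub_pos.2 (hfg x hx)
  have hFc : ContinuousOn (effectiveField H f g) (closure ω) := fun x hx =>
    (continuousAt_effectiveField H (hf x hx) (hg x hx)).continuousWithinAt
  obtain ⟨hj2, hR⟩ := memLp_and_radonNorm_ne_top hω hωb hfc hgc hapos hB hj hmin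
  set r := (radonNorm ω fun φ => curlDist ω j fun x => a x * φ x).toReal with hr
  have hr0 : 0 ≤ r := ENNReal.toReal_nonneg
  have hrj : (radonNorm ω fun φ => curlDist ω j fun x => a x * φ x) = ENNReal.ofReal r :=
    (ENNReal.ofReal_toReal hR).symm
  have hjr : ∀ φ, IsTest ω φ → (∀ x, |φ x| ≤ 1) → curlDist ω j (fun x => a x * φ x) ≤ r :=
    fun φ hφ h1 => le_toReal_radonNorm (T := fun φ => curlDist ω j fun x => a x * φ x) hR hφ h1
  have hvar {k : Plane → Plane} (hk : MemLp k 2 (volume.restrict ω)) {A : Set Plane}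
      (hA : MeasurableSet A) (hAω : A ⊆ ω)
      (hkA : ∀ φ, IsTest ω φ → curlDist ω k φ = ∫ x in A, φ x) :
      |∫ x in ω, inner ℝ (a x • (B x - j x)) (k x)| ≤ (∫ x in A, a x) / 2 := by
    have h (c : ℝ) (hc : |c| = 1) := variation_indicator hω hωb hf hg hapos hB hj hj2 hmin hr0 hrj
      hjr hk hA hAω hkA hc
    have h1 := h 1 (by simp)
    have h2 := h (-1) (by simp)
    have h3 : ∫ x in ω, inner ℝ (a x • (B x - j x)) (k x) =
        -∫ x in ω, inner ℝ (a x • (j x - B x)) (k x) := by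
      rw [← integral_neg]
      congr 1 with x
      rw [← inner_neg_left, ← smul_neg, neg_sub]
    rw [h3, abs_le]
    constructor <;> linarith
  have hvm : MemLp (fun x => a x • (B x - j x)) 2 (volume.restrict ω) :=
    memLp_smul_of_continuousOn_closure hω hωb hac (hB.sub hj2)
  obtain ⟨ζ, G, hζ, hG⟩ := exists_stream_function hωb.measure_lt_top hvm fun k hk hk0 => by
    have h := hvar hk MeasurableSet.empty (Set.empty_subset ω) fun φ hφ => by simp [hk0 φ hφ]
    simpa using h
  -- the currents carried by subsets of `ω` detect the size of `ζ`
  have hbound : ∀ᵐ x ∂(volume.restrict ω), |ζ x| ≤ a x / 2 := by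
    have : IsFiniteMeasure (volume.restrict ω) := ⟨by simpa using hωb.measure_lt_top⟩
    have hai : Integrable a (volume.restrict ω) :=
      memLp_one_iff_integrable.1 (memLp_of_continuousOn_closure hω hωb hac 1)
    refine ae_abs_le_of_setIntegral hω.measurableSet (hζ.memLp.integrable (by norm_num))
      (hai.div_const 2) fun A hA hAω => ?_
    obtain ⟨k, hk, hkA⟩ := exists_current_of_set hωb hA hAω
    have hind (u : Plane → ℝ) :
        ∫ x in ω, A.indicator (fun _ => (1 : ℝ)) x * u x = ∫ x in A, u x := by
      have h1 : ∀ x, A.indicator (fun _ => (1 : ℝ)) x * u x = A.indicator u x := fun x => by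
        by_cases hx : x ∈ A <;> simp [hx]
      simp only [h1]
      rw [integral_indicator hA, Measure.restrict_restrict hA, Set.inter_eq_left.2 hAω]
    have h1 := hζ.integral_inner_perp (μ := A.indicator fun _ => 1) hk
      ((memLp_const 1).indicator hA) fun φ hφ => by rw [hkA φ hφ, hind]
    rw [hind] at h1
    rw [← h1, integral_div]
    refine le_trans (le_of_eq ?_) (hvar hk hA hAω hkA)
    congr 2 with x
    rw [hG, real_inner_comm]
  have hmass : r / 2 ≤ ∫ x in ω, inner ℝ (j x) (perp (G x)) := by
    refine (variation_scaling hω hωb hf hg hapos hB hj hj2 hmin hr0 hrj hjr).trans_eq ?_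
    rw [← integral_neg]
    congr 1 with x
    rw [hG, real_inner_comm, ← inner_neg_right, ← smul_neg, neg_sub]
  refine ⟨ζ, G, ⟨⟨hζ, hbound⟩, fun ξ X hξ => ?_⟩, ?_⟩
  · exact obstacleEnergy_le hω hωb hac hapos hFc hB hcurl hj2 hζ hξ.1 hG
      ((integral_inner_perp_le hω hωb has hapos hj2 hjr hξ).trans hmass)
  · refine ae_restrict_of_forall_mem hω.measurableSet fun x hx => ?_
    have ha0 := (hapos x (subset_closure hx)).ne'
    rw [hG, smul_smul, one_div, inv_mul_cancel₀ ha0, one_smul, sub_sub_cancel]
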